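/- Let $T_1,\dots,T_m$ be bijective linear maps of $\mathbb R^d$ with largest singular values $\sigma_1(T_i)<\tfrac12$. For $a=(a_1,\dots,a_m)\in(\mathbb R^d)^m$ put $f_i(x)=T_ix+a_i$ and, for $\mathbf i=(i_1,i_2,\dots)\in\mathcal A^{\mathbb N}=\{1,\dots,m\}^{\mathbb N}$, let $\pi_a(\mathbf i)=\lim_{k\to\infty}f_{i_1}\circ\dots\circ f_{i_k}(0)$ be the projection onto the self-affine set $E_a=\bigcup_i f_i(E_a)$. Write $T_{\mathbf q}=T_{q_1}\circ\dots\circ T_{q_k}$ and $|\mathbf q|=k$ for a finite word $\mathbf q=q_1\cdots q_k$, $[\mathbf q]\subset\mathcal A^{\mathbb N}$ for the cylinder of sequences that begin with $\mathbf q$, $\mathbf i|_k=i_1\cdots i_k$, and $\sigma$ for the left shift. For $0\le t\le d$ let $\varphi^t(S)=\sigma_1(S)\cdots\sigma_{\lfloor t\rfloor}(S)\,\sigma_{\lfloor t\rfloor+1}(S)^{t-\lfloor t\rfloor}$ be the singular value function ($\sigma_1(S)\ge\dots\ge\sigma_d(S)$ the singular values of $S$; for $t=d$ the last factor is $1$),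 and let $\mathcal P(t)=\lim_{k\to\infty}\frac1k\log\sum_{|\mathbf q|=k}\varphi^t(T_{\mathbf q})$ be the pressure. Let $t\in[0,d]$ satisfy $\mathcal P(t)=0$, and suppose that there is a constant $D\in(0,1)$ with $\varphi^t(T_{\mathbf q\mathbf r})\ge D\,\varphi^t(T_{\mathbf q})\,\varphi^t(T_{\mathbf r})$ for all finite words $\mathbf q,\mathbf r$. Let $\mu$ be a Gibbs measure at $t$, that is, a $\sigma$-invariant Borel probability measure on $\mathcal A^{\mathbb N}$ for which there is a constant $C>0$ with $$C^{-1}\le\frac{\mu[\mathbf q]}{\varphi^t(T_{\mathbf q})\exp(-|\mathbf q|\,\mathcal P(t))}\le C\qquad\text{for all finite words }\mathbf q.$$ Let $(\ell_k)\subset\mathbb N$ be a non-decreasing sequence that tends to $\infty$, let $\mathbf j\in\mathcal A^{\mathbb N}$, and let $$R(\mathbf j)=\{\mathbf i\in\mathcal A^{\mathbb N}:\ \sigma^k(\mathbf i)|_{\ell_k}=\mathbf j|_{\ell_k}\text{ for infinitely many }k\}.$$ 1. If $\sum_{k=1}^\infty\mu([\mathbf j|_{\ell_k}])=\infty$, then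 $(\pi_a)_*\mu\big(\pi_a(R(\mathbf j))\big)=1$ for every $a\in(\mathbb R^d)^m$. 2. If $\sum_{k=1}^\infty\mu([\mathbf j|_{\ell_k}])<\infty$, then $(\pi_a)_*\mu\big(\pi_a(R(\mathbf j))\big)=0$ for Lebesgue-almost every $a\in(\mathbb R^d)^m$, and also for every individual $a$ such that $\mu$-almost every $\mathbf i$ is the only point of the fibre $\pi_a^{-1}(\pi_a(\mathbf i))$ (in particular whenever $\pi_a$ is injective). -/

import Mathlib

open Filter Topology MeasureTheory

noncomputable section

namespace SelfAffine

variable {d m : ℕ}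

/-- The singular value function
`φ^t(S) = σ₁(S) ⋯ σ_⌊t⌋(S) · σ_{⌊t⌋+1}(S)^{t}` for `0 ≤ t ≤ d`, where the last exponent is the
fractional part of `t`. `LinearMap.singularValues` is indexed from `0` and lists the singular values
in decreasing order; for `t = d` the last factor is `0 ^ 0 = 1`. -/
def phi (t : ℝ) (S : Module.End ℝ (EuclideanSpace ℝ (Fin d))) : ℝ :=
  (∏ n ∈ Finset.range ⌊t⌋₊, S.singularValues n) * S.singularValues ⌊t⌋₊ ^ Int.fract t

/-- `T_q = T_{q₁} ∘ ⋯ ∘ T_{q_k}` for a finite word `q = q₁ … q_k`. -/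
def wordMap (T : Fin m → Module.End ℝ (EuclideanSpace ℝ (Fin d))) (q : List (Fin m)) :
    Module.End ℝ (EuclideanSpace ℝ (Fin d)) :=
  (q.map T).prod

/-- `f_q = f_{q₁} ∘ ⋯ ∘ f_{q_k}` for a finite word `q`, where `f_i(x) = T_i x + a_i`. -/
def wordAffine (T : Fin m → Module.End ℝ (EuclideanSpace ℝ (Fin d)))
    (a : Fin m → EuclideanSpace ℝ (Fin d)) (q : List (Fin m)) (x : EuclideanSpace ℝ (Fin d)) :
    EuclideanSpace ℝ (Fin d) :=
  q.foldr (fun i y => T i y + a i) x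

/-- The truncation `i|_k = i₁ … i_k` of a sequence. -/
def trunc (i : ℕ → Fin m) (k : ℕ) : List (Fin m) :=
  List.ofFn fun n : Fin k => i n

/-- The left shift `σ` on the sequence space. -/
def shift (i : ℕ → Fin m) : ℕ → Fin m :=
  fun n => i (n + 1)

/-- The cylinder `[q]` of all sequences that begin with the finite word `q`. -/
def cylinder (q : List (Fin m)) : Set (ℕ → Fin m) :=
  {i | trunc i q.length = q}

/-- The projection `π(i) = lim_k f_{i₁} ∘ ⋯ ∘ f_{i_k} (0)`; the limit exists for contractions. -/
def proj (T : Fin m → Module.End ℝ (EuclideanSpace ℝ (Fin d)))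
    (a : Fin m → EuclideanSpace ℝ (Fin d)) (i : ℕ → Fin m) : EuclideanSpace ℝ (Fin d) :=
  limUnder atTop fun k : ℕ => wordAffine T a (trunc i k) 0

/-- The symbolic recurring set `R(j)`: all `i` with `σ^k(i)|_{ℓ_k} = j|_{ℓ_k}` for infinitely
many `k`. -/
def recurringSet (j : ℕ → Fin m) (l : ℕ → ℕ) : Set (ℕ → Fin m) :=
  {i | ∃ᶠ k in atTop, trunc (shift^[k] i) (l k) = trunc j (l k)}

/-- `HasPressure T s p`: the limit `𝒫(s) = lim_k (1/k) log ∑_{|i| = k} φ^s(T_i)` exists and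
equals `p`. -/
def HasPressure (T : Fin m → Module.End ℝ (EuclideanSpace ℝ (Fin d))) (s p : ℝ) : Prop :=
  Tendsto
    (fun k : ℕ => (1 / (k : ℝ)) * Real.log (∑ w : Fin k → Fin m, phi s (wordMap T (List.ofFn w))))
    atTop (𝓝 p)

/-- `μ` is a Gibbs measure at `t`: a shift-invariant probability measure on the sequence space with
`C⁻¹ ≤ μ[q] / (φ^t(T_q) exp(-|q| 𝒫(t))) ≤ C` for all finite words `q`. -/
structure IsGibbsMeasure (T : Fin m → Module.End ℝ (EuclideanSpace ℝ (Fin d))) (t : ℝ)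
    (μ : Measure (ℕ → Fin m)) : Prop where
  isProbabilityMeasure : IsProbabilityMeasure μ
  invariant : MeasurePreserving shift μ μ
  gibbs : ∃ p : ℝ, HasPressure T t p ∧ ∃ C : ℝ, 0 < C ∧ ∀ q : List (Fin m),
    C⁻¹ ≤ μ.real (cylinder q) / (phi t (wordMap T q) * Real.exp (-(q.length : ℝ) * p)) ∧
    μ.real (cylinder q) / (phi t (wordMap T q) * Real.exp (-(q.length : ℝ) * p)) ≤ C

end SelfAffine

end

/-! At zero pressure the Gibbs property makes $\mu[\mathbf q]$ comparable to $\varphi^t(T_{\mathbf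
q})$. Write $E_k$ for the event $\sigma^k(\mathbf i)|_{\ell_k}=\mathbf j|_{\ell_k}$; by invariance
$\mu(E_k)=\mu[\mathbf j|_{\ell_k}]$.

Divergence. Quasi-multiplicativity gives $c\,\mu[\mathbf q]\mu[\mathbf r]\le\mu[\mathbf{qr}]$, and
contraction gives $\mu[\mathbf{qr}]\le K\theta^{|\mathbf q|}\mu[\mathbf r]$ with $\theta<1$ when
$t>0$. If, with probability $v>0$, no event occurs from time $a$ on, then after $E_k$ with $k\ge a$
there is no event beyond $k+\ell_k$ with conditional probability at least $cv$. An overlapping event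
at distance $s$ has conditional probability at most $K\theta^s$, so for large $L$ those with $s\ge
L$ cost at most $cv/2$ together. Hence $k$ is the last occurrence in its residue class mod $L$ with
probability at least $\frac{cv}{2}\mu(E_k)$. Last occurrences in one class are disjoint, so
$\sum\mu(E_k)<\infty$, a contradiction (`measure_recurringSet_eq_one`). Neither ergodicity nor a
second-moment estimate is used. If $t=0$, zero pressure forces $m=1$.

Convergence. Borel–Cantelli makes $R(\mathbf j)$ null, but $\pi_a^{-1}(\pi_a(R(\mathbf j)))$ may be
larger. If $\pi_a(\mathbf i)=\pi_a(\mathbf i')$ with $\mathbf i'\in R(\mathbf j)$ and $\mathbf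
i\ne\mathbf i'$, deleting the common prefix leaves a point $x=\sigma^p\mathbf i$ whose projection
meets infinitely many cylinders $[\mathbf r\,\mathbf j|_{\ell_k}]$, $|\mathbf r|=k$, with another
first letter (`frequently_collision`). For fixed $x$, transversality bounds the volume of such $a$
in a ball by a constant times $|\det T_{\mathbf w}|\le\varphi^t(T_{\mathbf w})\lesssim\mu[\mathbf
w]$, where $\mathbf w=\mathbf r\,\mathbf j|_{\ell_k}$. Summing over $\mathbf r$ gives a multiple of
$\mu[\mathbf j|_{\ell_k}]$. Borel–Cantelli in $a$, Fubini and invariance exclude these collisions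
almost surely. -/

/-! ### Singular values -/

open scoped RealInnerProductSpace in
theorem LinearMap.norm_sq_apply_eq_sum_singularValues {E F : Type*} [NormedAddCommGroup E]
    [InnerProductSpace ℝ E] [FiniteDimensional ℝ E] [NormedAddCommGroup F] [InnerProductSpace ℝ F]
    [FiniteDimensional ℝ F] (U : E →ₗ[ℝ] F) {N : ℕ} (hN : Module.finrank ℝ E = N) (x : E) :
    ‖U x‖ ^ 2 = ∑ i : Fin N, U.singularValues i ^ 2 *
      ⟪U.isSymmetric_adjoint_comp_self.eigenvectorBasis hN i, x⟫ ^ 2 := by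
  have h1 : ‖U x‖ ^ 2 = ⟪x, (U.adjoint ∘ₗ U) x⟫ := by
    rw [LinearMap.comp_apply, LinearMap.adjoint_inner_right, real_inner_self_eq_norm_sq]
  rw [h1, ← (U.isSymmetric_adjoint_comp_self.eigenvectorBasis hN).sum_inner_mul_inner]
  refine Finset.sum_congr rfl fun i _ => ?_
  rw [← U.isSymmetric_adjoint_comp_self, LinearMap.IsSymmetric.apply_eigenvectorBasis,
    U.sq_singularValues_fin hN, real_inner_comm, real_inner_smul_left]
  simp only [RCLike.ofReal_real_eq_id, _root_.id]
  ring

theorem LinearMap.norm_apply_le_singularValues_zero {E F : Type*} [NormedAddCommGroup E]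
    [InnerProductSpace ℝ E] [FiniteDimensional ℝ E] [NormedAddCommGroup F] [InnerProductSpace ℝ F]
    [FiniteDimensional ℝ F] (U : E →ₗ[ℝ] F) (x : E) : ‖U x‖ ≤ U.singularValues 0 * ‖x‖ := by
  refine le_of_sq_le_sq ?_ (mul_nonneg (U.singularValues_nonneg 0) (norm_nonneg x))
  rw [U.norm_sq_apply_eq_sum_singularValues rfl, mul_pow,
    ← (U.isSymmetric_adjoint_comp_self.eigenvectorBasis rfl).sum_sq_inner_right x, Finset.mul_sum]
  refine Finset.sum_le_sum fun i _ => mul_le_mul_of_nonneg_right ?_ (sq_nonneg _)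
  exact pow_le_pow_left₀ (U.singularValues_nonneg _) (U.singularValues_antitone (Nat.zero_le _)) 2

-- Courant–Fischer by a dimension count: some nonzero $x$ is orthogonal to the singular directions
-- of $U$ after the $n$-th and to those of $V$ before it. For it $\sigma_n(U)\|x\|\le\|Ux\|$ and
-- $\|Vx\|\le\sigma_n(V)\|x\|$.
open scoped RealInnerProductSpace in
theorem LinearMap.singularValues_le_mul_of_norm_le {E F G : Type*} [NormedAddCommGroup E]
    [InnerProductSpace ℝ E] [FiniteDimensional ℝ E] [NormedAddCommGroup F] [InnerProductSpace ℝ F]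
    [FiniteDimensional ℝ F] [NormedAddCommGroup G] [InnerProductSpace ℝ G]
    [FiniteDimensional ℝ G] (U : E →ₗ[ℝ] F) (V : E →ₗ[ℝ] G) {c : ℝ} (hc : 0 ≤ c)
    (h : ∀ x, ‖U x‖ ≤ c * ‖V x‖) (n : ℕ) :
    U.singularValues n ≤ c * V.singularValues n := by
  by_cases hn : Module.finrank ℝ E ≤ n
  · simp [singularValues_of_finrank_le _ hn]
  push Not at hn
  obtain ⟨N, hN⟩ : ∃ N, Module.finrank ℝ E = N := ⟨_, rfl⟩
  rw [hN] at hn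
  let b := U.isSymmetric_adjoint_comp_self.eigenvectorBasis hN
  let b' := V.isSymmetric_adjoint_comp_self.eigenvectorBasis hN
  let k : Fin N := ⟨n, hn⟩
  -- There are $N-1$ linear conditions in dimension $N$, so the kernel is nontrivial.
  let g : E →ₗ[ℝ] ({i : Fin N // i ≠ k} → ℝ) :=
    LinearMap.pi fun i => innerₛₗ ℝ (if k < i.1 then b i.1 else b' i.1)
  have hg : g.ker ≠ ⊥ := by
    apply LinearMap.ker_ne_bot_of_finrank_lt
    have : 0 < N := by omega
    simp [hN]
    omega
  obtain ⟨x, hx, hx0⟩ := Submodule.exists_mem_ne_zero_of_ne_bot hg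
  have hgx : ∀ i (hi : i ≠ k), ⟪(if k < i then b i else b' i), x⟫ = 0 := fun i hi =>
    congrFun (LinearMap.mem_ker.1 hx) ⟨i, hi⟩
  have hU : (U.singularValues n * ‖x‖) ^ 2 ≤ ‖U x‖ ^ 2 := by
    rw [U.norm_sq_apply_eq_sum_singularValues hN, mul_pow, ← b.sum_sq_inner_right x,
      Finset.mul_sum]
    refine Finset.sum_le_sum fun i _ => ?_
    rcases lt_or_ge k i with hi | hi
    · have := hgx i hi.ne'
      rw [if_pos hi] at this
      simp [this, b]
    · exact mul_le_mul_of_nonneg_right (pow_le_pow_left₀ (U.singularValues_nonneg _)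
        (U.singularValues_antitone hi) 2) (sq_nonneg _)
  have hV : ‖V x‖ ^ 2 ≤ (V.singularValues n * ‖x‖) ^ 2 := by
    rw [V.norm_sq_apply_eq_sum_singularValues hN, mul_pow, ← b'.sum_sq_inner_right x,
      Finset.mul_sum]
    refine Finset.sum_le_sum fun i _ => ?_
    rcases lt_or_ge i k with hi | hi
    · have := hgx i hi.ne
      rw [if_neg hi.not_gt] at this
      simp [this, b']
    · exact mul_le_mul_of_nonneg_right (pow_le_pow_left₀ (V.singularValues_nonneg _)
        (V.singularValues_antitone hi) 2) (sq_nonneg _)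
  have hxpos : 0 < ‖x‖ := norm_pos_iff.2 hx0
  have h1 := le_of_sq_le_sq hU (norm_nonneg _)
  have h2 := le_of_sq_le_sq hV (mul_nonneg (V.singularValues_nonneg _) (norm_nonneg _))
  refine le_of_mul_le_mul_right ?_ hxpos
  calc _ ≤ ‖U x‖ := h1
    _ ≤ c * ‖V x‖ := h x
    _ ≤ c * (V.singularValues n * ‖x‖) := by gcongr
    _ = _ := by ring

/-! ### The singular value function -/

namespace SelfAffine

variable {d m : ℕ}

theorem phi_nonneg (t : ℝ) (S : Module.End ℝ (EuclideanSpace ℝ (Fin d))) : 0 ≤ phi t S :=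
  mul_nonneg (Finset.prod_nonneg fun _ _ => S.singularValues_nonneg _)
    (Real.rpow_nonneg (S.singularValues_nonneg _) _)

theorem phi_mul_le {t c : ℝ} (ht : 0 ≤ t) (hc : 0 ≤ c)
    (S U : Module.End ℝ (EuclideanSpace ℝ (Fin d))) (hS : ∀ x, ‖S x‖ ≤ c * ‖x‖) :
    phi t (S * U) ≤ c ^ t * phi t U := by
  have key : ∀ n, (S * U).singularValues n ≤ c * U.singularValues n := fun n =>
    (S * U).singularValues_le_mul_of_norm_le U hc (fun x => hS _) n
  have hfl : ((⌊t⌋₊ : ℕ) : ℝ) + Int.fract t = t := by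
    rw [natCast_floor_eq_intCast_floor ht, Int.floor_add_fract]
  have h1 : ∏ n ∈ Finset.range ⌊t⌋₊, (S * U).singularValues n ≤
      c ^ ⌊t⌋₊ * ∏ n ∈ Finset.range ⌊t⌋₊, U.singularValues n := by
    calc _ ≤ ∏ n ∈ Finset.range ⌊t⌋₊, (c * U.singularValues n) :=
          Finset.prod_le_prod (fun _ _ => LinearMap.singularValues_nonneg _ _) fun n _ => key n
      _ = _ := by simp [Finset.prod_mul_distrib]
  have h2 : (S * U).singularValues ⌊t⌋₊ ^ Int.fract t ≤
      c ^ Int.fract t * U.singularValues ⌊t⌋₊ ^ Int.fract t := by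
    rw [← Real.mul_rpow hc (LinearMap.singularValues_nonneg _ _)]
    exact Real.rpow_le_rpow (LinearMap.singularValues_nonneg _ _) (key _) (Int.fract_nonneg t)
  calc phi t (S * U) ≤ (c ^ ⌊t⌋₊ * ∏ n ∈ Finset.range ⌊t⌋₊, U.singularValues n) *
        (c ^ Int.fract t * U.singularValues ⌊t⌋₊ ^ Int.fract t) :=
        mul_le_mul h1 h2 (Real.rpow_nonneg (LinearMap.singularValues_nonneg _ _) _)
          (mul_nonneg (pow_nonneg hc _)
            (Finset.prod_nonneg fun _ _ => LinearMap.singularValues_nonneg _ _))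
    _ = (c ^ ⌊t⌋₊ * c ^ Int.fract t) * phi t U := by unfold phi; ring
    _ = c ^ t * phi t U := by
      rw [← Real.rpow_natCast, ← Real.rpow_add_of_nonneg hc (Nat.cast_nonneg _)
        (Int.fract_nonneg t), hfl]

/-- The determinant is the product of all singular values; as these are at most $1$, dropping those
past index $\lfloor t\rfloor$ and lowering the exponent at that index can only increase the product.
-/
theorem abs_det_le_phi {t : ℝ} (ht : t ∈ Set.Icc (0 : ℝ) d)
    (S : Module.End ℝ (EuclideanSpace ℝ (Fin d))) (hS : S.singularValues 0 ≤ 1) :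
    |LinearMap.det S| ≤ phi t S := by
  have hdet : |LinearMap.det S| = ∏ n ∈ Finset.range d, S.singularValues n := by
    rw [← LinearMap.normDet_eq_abs_det, LinearMap.normDet_eq_prod_singularValues]
    simp
  have hle : ∀ n, S.singularValues n ≤ 1 := fun n =>
    (S.singularValues_antitone (Nat.zero_le n)).trans hS
  have hk : ⌊t⌋₊ ≤ d := by
    have := Nat.floor_le_floor ht.2
    simpa using this
  have hP : 0 ≤ ∏ n ∈ Finset.range ⌊t⌋₊, S.singularValues n :=
    Finset.prod_nonneg fun _ _ => S.singularValues_nonneg _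
  rw [hdet, ← Finset.prod_range_mul_prod_Ico _ hk, phi]
  refine mul_le_mul_of_nonneg_left ?_ hP
  rcases hk.eq_or_lt with h | h
  · have htd : t = d := le_antisymm ht.2 (by rw [← h]; exact Nat.floor_le ht.1)
    simp [htd]
  · rw [Finset.prod_eq_prod_Ico_succ_bot h]
    calc _ ≤ S.singularValues ⌊t⌋₊ * 1 :=
          mul_le_mul_of_nonneg_left (Finset.prod_le_one
            (fun _ _ => S.singularValues_nonneg _) fun n _ => hle n) (S.singularValues_nonneg _)
      _ = S.singularValues ⌊t⌋₊ ^ (1 : ℝ) := by simp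
      _ ≤ _ := Real.rpow_le_rpow_of_exponent_ge_of_imp (S.singularValues_nonneg _) (hle _)
        (Int.fract_lt_one t).le (by simp)

/-! ### Cylinders and shift-invariant measures -/

@[simp]
theorem length_trunc (i : ℕ → Fin m) (k : ℕ) : (trunc i k).length = k := by
  simp [trunc]

theorem trunc_eq_trunc_iff {i i' : ℕ → Fin m} {k : ℕ} :
    trunc i k = trunc i' k ↔ ∀ n < k, i n = i' n := by
  rw [trunc, trunc, List.ofFn_inj, funext_iff]
  exact ⟨fun h n hn => h ⟨n, hn⟩, fun h n => h n n.2⟩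

theorem shift_iterate_apply (k : ℕ) (i : ℕ → Fin m) (n : ℕ) : shift^[k] i n = i (k + n) := by
  induction k generalizing i with
  | zero => simp
  | succ k ih => rw [Function.iterate_succ_apply, ih, shift]; congr 1; omega

theorem mem_cylinder_trunc {i j : ℕ → Fin m} {k : ℕ} :
    i ∈ cylinder (trunc j k) ↔ ∀ n < k, i n = j n := by
  rw [cylinder, Set.mem_ofPred_eq, length_trunc, trunc_eq_trunc_iff]

theorem mem_cylinder_iff {i : ℕ → Fin m} {q : List (Fin m)} :
    i ∈ cylinder q ↔ ∀ n (h : n < q.length), i n = q[n] := by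
  rw [cylinder, Set.mem_ofPred_eq, List.ext_get_iff]
  simp [trunc]

theorem cylinder_append (q r : List (Fin m)) :
    cylinder (q ++ r) = cylinder q ∩ shift^[q.length] ⁻¹' cylinder r := by
  ext i
  simp only [Set.mem_inter_iff, Set.mem_preimage, mem_cylinder_iff, shift_iterate_apply]
  constructor
  · intro h
    refine ⟨fun n hn => ?_, fun n hn => ?_⟩
    · rw [h n (by simp; omega), List.getElem_append_left hn]
    · rw [h _ (by simp; omega), List.getElem_append_right (by omega)]
      simp
  · rintro ⟨h1, h2⟩ n hn
    rcases lt_or_ge n q.length with h | h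
    · rw [h1 n h, List.getElem_append_left h]
    · rw [List.getElem_append_right h, ← h2 _ (by simp at hn; omega)]
      congr 1; omega

theorem isClopen_cylinder (q : List (Fin m)) : IsClopen (cylinder q) := by
  have : cylinder q = ⋂ n : Fin q.length, (fun i : ℕ → Fin m => i n) ⁻¹' {q[n]} := by
    ext i
    simp only [mem_cylinder_iff, Set.mem_iInter, Set.mem_preimage, Set.mem_singleton_iff]
    exact ⟨fun h n => h n n.2, fun h n hn => h ⟨n, hn⟩⟩
  rw [this]
  exact isClopen_iInter_of_finite fun n => (isClopen_discrete _).preimage (continuous_apply _)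

theorem measurableSet_cylinder (q : List (Fin m)) : MeasurableSet (cylinder q) :=
  (isClopen_cylinder q).1.measurableSet

theorem measurable_shift : Measurable (shift : (ℕ → Fin m) → ℕ → Fin m) :=
  measurable_pi_lambda _ fun _ => measurable_pi_apply _

theorem trunc_eq_of_mem_cylinder_ofFn {n : ℕ} {w : Fin n → Fin m} {i : ℕ → Fin m} :
    i ∈ cylinder (List.ofFn w) ↔ (fun k : Fin n => i k) = w := by
  simp only [mem_cylinder_iff, List.length_ofFn, List.getElem_ofFn, funext_iff]
  exact ⟨fun h k => h k k.2, fun h k hk => h ⟨k, hk⟩⟩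

theorem measure_eq_sum_inter_cylinder (μ : Measure (ℕ → Fin m)) (n : ℕ) {A : Set (ℕ → Fin m)}
    (hA : MeasurableSet A) :
    μ A = ∑ w : Fin n → Fin m, μ (cylinder (List.ofFn w) ∩ A) := by
  have hU : A = ⋃ w ∈ (Finset.univ : Finset (Fin n → Fin m)), cylinder (List.ofFn w) ∩ A := by
    ext i
    simp [trunc_eq_of_mem_cylinder_ofFn]
  conv_lhs => rw [hU]
  refine measure_biUnion_finset ?_ fun w _ => (measurableSet_cylinder _).inter hA
  intro w _ w' _ hne
  refine Set.disjoint_left.2 fun i hi hi' => hne ?_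
  rw [← trunc_eq_of_mem_cylinder_ofFn.1 hi.1, ← trunc_eq_of_mem_cylinder_ofFn.1 hi'.1]

theorem sum_measure_cylinder_append {μ : Measure (ℕ → Fin m)} (hμ : MeasurePreserving shift μ μ)
    (n : ℕ) (r : List (Fin m)) :
    ∑ w : Fin n → Fin m, μ (cylinder (List.ofFn w ++ r)) = μ (cylinder r) := by
  have h := measure_eq_sum_inter_cylinder μ n
    ((measurable_shift.iterate n) (measurableSet_cylinder r))
  rw [(hμ.iterate n).measure_preimage (measurableSet_cylinder r).nullMeasurableSet] at h
  simp [h, cylinder_append]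

/-- A set that depends only on the first $M$ letters is a disjoint union of cylinders of length $M$,
so quasi-independence passes from cylinders to it by summation. -/
theorem mul_measureReal_le_measureReal_cylinder_inter {μ : Measure (ℕ → Fin m)} [IsFiniteMeasure μ]
    {c : ℝ} (hc : ∀ q r : List (Fin m),
      c * μ.real (cylinder q) * μ.real (cylinder r) ≤ μ.real (cylinder (q ++ r)))
    (q : List (Fin m)) {M : ℕ} {B : Set (ℕ → Fin m)} (hBm : MeasurableSet B)
    (hB : ∀ x y, (∀ n < M, x n = y n) → x ∈ B → y ∈ B) :
    c * μ.real (cylinder q) * μ.real B ≤ μ.real (cylinder q ∩ shift^[q.length] ⁻¹' B) := by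
  classical
  have hreal : ∀ {A : Set (ℕ → Fin m)}, MeasurableSet A →
      μ.real A = ∑ w : Fin M → Fin m, μ.real (cylinder (List.ofFn w) ∩ A) := fun {A} hA => by
    rw [measureReal_def, measure_eq_sum_inter_cylinder μ M hA,
      ENNReal.toReal_sum fun _ _ => measure_ne_top _ _]
    rfl
  have hmeas : MeasurableSet (shift^[q.length] ⁻¹' B) := (measurable_shift.iterate _) hBm
  have hsum : μ.real (cylinder q ∩ shift^[q.length] ⁻¹' B) = ∑ w : Fin M → Fin m,
      μ.real (cylinder q ∩ shift^[q.length] ⁻¹' (cylinder (List.ofFn w) ∩ B)) := by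
    have hU : cylinder q ∩ shift^[q.length] ⁻¹' B = ⋃ w ∈ (Finset.univ : Finset (Fin M → Fin m)),
        cylinder q ∩ shift^[q.length] ⁻¹' (cylinder (List.ofFn w) ∩ B) := by
      ext i
      simp [trunc_eq_of_mem_cylinder_ofFn]
    conv_lhs => rw [hU]
    refine measureReal_biUnion_finset ?_ fun w _ => (measurableSet_cylinder q).inter
      ((measurable_shift.iterate _) ((measurableSet_cylinder _).inter hBm))
    intro w _ w' _ hne
    refine Set.disjoint_left.2 fun i hi hi' => hne ?_
    rw [← trunc_eq_of_mem_cylinder_ofFn.1 hi.2.1, ← trunc_eq_of_mem_cylinder_ofFn.1 hi'.2.1]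
  rw [hsum, hreal hBm, Finset.mul_sum]
  refine Finset.sum_le_sum fun w _ => ?_
  by_cases hw : ∃ x ∈ B, x ∈ cylinder (List.ofFn w)
  · obtain ⟨x, hxB, hxw⟩ := hw
    have hsub : cylinder (List.ofFn w) ∩ B = cylinder (List.ofFn w) := by
      refine Set.inter_eq_left.2 fun y hy => hB x y (fun n hn => ?_) hxB
      have := (trunc_eq_of_mem_cylinder_ofFn.1 hxw).trans (trunc_eq_of_mem_cylinder_ofFn.1 hy).symm
      exact congrFun this ⟨n, hn⟩
    rw [hsub, ← cylinder_append]
    exact hc _ _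
  · have : cylinder (List.ofFn w) ∩ B = ∅ := by
      ext y
      simp only [Set.mem_inter_iff, Set.mem_empty_iff_false, iff_false, not_and]
      exact fun h1 h2 => hw ⟨y, h2, h1⟩
    simp [this]

/-! ### Consequences of the Gibbs property -/

theorem IsGibbsMeasure.exists_bounds {T : Fin m → Module.End ℝ (EuclideanSpace ℝ (Fin d))} {t : ℝ}
    {μ : Measure (ℕ → Fin m)} (hμ : IsGibbsMeasure T t μ) (hzero : HasPressure T t 0) :
    ∃ C : ℝ, 0 < C ∧ ∀ q, μ.real (cylinder q) ≤ C * phi t (wordMap T q) ∧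
      phi t (wordMap T q) ≤ C * μ.real (cylinder q) := by
  obtain ⟨p, hp, C, hC, h⟩ := hμ.gibbs
  have hp0 : p = 0 := tendsto_nhds_unique hp hzero
  refine ⟨C, hC, fun q => ?_⟩
  obtain ⟨h1, h2⟩ := h q
  simp only [hp0, mul_zero, Real.exp_zero, mul_one] at h1 h2
  -- Division by zero gives $0$, so a vanishing $\varphi^t$ would contradict the positive lower
  -- Gibbs bound.
  have hpos : 0 < phi t (wordMap T q) := by
    refine (phi_nonneg _ _).lt_of_ne fun h0 => ?_
    rw [← h0, div_zero] at h1
    exact absurd h1 (not_le.2 (inv_pos.2 hC))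
  refine ⟨(div_le_iff₀ hpos).1 h2, ?_⟩
  rw [le_div_iff₀ hpos, inv_mul_le_iff₀ hC] at h1
  exact h1

theorem IsGibbsMeasure.exists_mul_le {T : Fin m → Module.End ℝ (EuclideanSpace ℝ (Fin d))} {t : ℝ}
    {μ : Measure (ℕ → Fin m)} (hμ : IsGibbsMeasure T t μ) (hzero : HasPressure T t 0)
    (hquasi : ∃ D ∈ Set.Ioo (0 : ℝ) 1, ∀ q r : List (Fin m),
      D * phi t (wordMap T q) * phi t (wordMap T r) ≤ phi t (wordMap T (q ++ r))) :
    ∃ c : ℝ, 0 < c ∧ ∀ q r : List (Fin m),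
      c * μ.real (cylinder q) * μ.real (cylinder r) ≤ μ.real (cylinder (q ++ r)) := by
  obtain ⟨C, hC, h⟩ := hμ.exists_bounds hzero
  obtain ⟨D, hD, hDq⟩ := hquasi
  refine ⟨D / C ^ 3, div_pos hD.1 (by positivity), fun q r => ?_⟩
  have h1 := (h q).1
  have h2 := (h r).1
  have h3 := (h (q ++ r)).2
  have hq := phi_nonneg t (wordMap T q)
  have h4 : D * (μ.real (cylinder q) * μ.real (cylinder r)) ≤
      C ^ 3 * μ.real (cylinder (q ++ r)) := by
    calc _ ≤ D * ((C * phi t (wordMap T q)) * (C * phi t (wordMap T r))) :=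
          mul_le_mul_of_nonneg_left (mul_le_mul h1 h2 measureReal_nonneg (by positivity)) hD.1.le
      _ = C ^ 2 * (D * phi t (wordMap T q) * phi t (wordMap T r)) := by ring
      _ ≤ C ^ 2 * (C * μ.real (cylinder (q ++ r))) := by
        exact mul_le_mul_of_nonneg_left ((hDq q r).trans h3) (by positivity)
      _ = _ := by ring
  rw [mul_assoc, div_mul_eq_mul_div, div_le_iff₀ (by positivity)]
  linarith

/-! ### Recurrence events and Borel–Cantelli -/

/-- The event `σ^k(i)|_{ℓ_k} = j|_{ℓ_k}`. -/
def recurEvent (j : ℕ → Fin m) (l : ℕ → ℕ) (k : ℕ) : Set (ℕ → Fin m) :=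
  shift^[k] ⁻¹' cylinder (trunc j (l k))

theorem mem_recurEvent {j : ℕ → Fin m} {l : ℕ → ℕ} {k : ℕ} {i : ℕ → Fin m} :
    i ∈ recurEvent j l k ↔ ∀ n < l k, i (k + n) = j n := by
  simp only [recurEvent, Set.mem_preimage, mem_cylinder_trunc, shift_iterate_apply]

theorem mem_recurringSet {j : ℕ → Fin m} {l : ℕ → ℕ} {i : ℕ → Fin m} :
    i ∈ recurringSet j l ↔ ∃ᶠ k in atTop, i ∈ recurEvent j l k := by
  simp [recurringSet, recurEvent, cylinder]

theorem measurableSet_recurEvent (j : ℕ → Fin m) (l : ℕ → ℕ) (k : ℕ) :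
    MeasurableSet (recurEvent j l k) :=
  (measurable_shift.iterate k) (measurableSet_cylinder _)

theorem measure_recurEvent {μ : Measure (ℕ → Fin m)} (hμ : MeasurePreserving shift μ μ)
    (j : ℕ → Fin m) (l : ℕ → ℕ) (k : ℕ) :
    μ (recurEvent j l k) = μ (cylinder (trunc j (l k))) :=
  (hμ.iterate k).measure_preimage (measurableSet_cylinder _).nullMeasurableSet

theorem measurableSet_recurringSet (j : ℕ → Fin m) (l : ℕ → ℕ) :
    MeasurableSet (recurringSet j l) := by
  have : recurringSet j l = limsup (recurEvent j l) atTop := by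
    ext i
    rw [mem_recurringSet, mem_limsup_iff_frequently_mem]
  rw [this]
  exact MeasurableSet.measurableSet_limsup fun k => measurableSet_recurEvent j l k

theorem measure_recurringSet_eq_zero {μ : Measure (ℕ → Fin m)} (hμ : MeasurePreserving shift μ μ)
    {j : ℕ → Fin m} {l : ℕ → ℕ} (h : ∑' k, μ (cylinder (trunc j (l k))) ≠ ⊤) :
    μ (recurringSet j l) = 0 := by
  have : recurringSet j l = {i | ∃ᶠ k in atTop, i ∈ recurEvent j l k} :=
    Set.ext fun i => mem_recurringSet
  rw [this]
  refine measure_setOfPred_frequently_eq_zero ?_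
  simpa only [Set.ofPred_mem_eq, measure_recurEvent hμ] using h

/-! ### The divergent case -/

section Divergence

variable {μ : Measure (ℕ → Fin m)} {j : ℕ → Fin m} {l : ℕ → ℕ}

/-- No event with index in `[n, N]` occurs, for a sequence whose indices are shifted by `n`. -/
def noRecurrence (j : ℕ → Fin m) (l : ℕ → ℕ) (n N : ℕ) : Set (ℕ → Fin m) :=
  {x | ∀ p, n + p ≤ N → ¬ ∀ k < l (n + p), x (p + k) = j k}

theorem mem_preimage_noRecurrence {n N : ℕ} {i : ℕ → Fin m} :
    shift^[n] i ∈ noRecurrence j l n N ↔ ∀ k, n ≤ k → k ≤ N → i ∉ recurEvent j l k := by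
  simp only [noRecurrence, Set.mem_ofPred_eq, shift_iterate_apply, mem_recurEvent]
  constructor
  · intro h k hnk hkN
    obtain ⟨p, rfl⟩ := Nat.exists_eq_add_of_le hnk
    simpa only [add_assoc] using h p hkN
  · intro h p hp
    simpa only [add_assoc] using h (n + p) (Nat.le_add_right _ _) hp

theorem noRecurrence_congr (hmono : Monotone l) {n N : ℕ} {x y : ℕ → Fin m}
    (h : ∀ k < N + l N, x k = y k) (hx : x ∈ noRecurrence j l n N) : y ∈ noRecurrence j l n N := by
  intro p hp hy
  refine hx p hp fun k hk => ?_
  have := hmono hp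
  rw [h (p + k) (by omega), hy k hk]

theorem measurableSet_noRecurrence (n N : ℕ) : MeasurableSet (noRecurrence j l n N) := by
  have : noRecurrence j l n N =
      ⋂ p : ℕ, ⋂ (_ : n + p ≤ N), (shift^[p] ⁻¹' cylinder (trunc j (l (n + p))))ᶜ := by
    ext x
    simp [noRecurrence, mem_cylinder_trunc, shift_iterate_apply]
  rw [this]
  exact MeasurableSet.iInter fun p => MeasurableSet.iInter fun _ =>
    ((measurable_shift.iterate p) (measurableSet_cylinder _)).compl

/-- Overlapping occurrences force the word $\mathbf j|_s\,\mathbf j|_{\ell_k}$ at time $k$: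
monotonicity of $\ell$ ensures that the second occurrence matches at least $\ell_k$ letters. -/
theorem measureReal_recurEvent_inter_le [IsFiniteMeasure μ] (hμ : MeasurePreserving shift μ μ)
    (hmono : Monotone l) {K θ : ℝ} (hup : ∀ q r : List (Fin m),
      μ.real (cylinder (q ++ r)) ≤ K * θ ^ q.length * μ.real (cylinder r))
    {k s : ℕ} (hs : s < l k) :
    μ.real (recurEvent j l k ∩ recurEvent j l (k + s)) ≤
      K * θ ^ s * μ.real (recurEvent j l k) := by
  have hsub : recurEvent j l k ∩ recurEvent j l (k + s) ⊆
      shift^[k] ⁻¹' cylinder (trunc j s ++ trunc j (l k)) := by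
    rintro i ⟨h1, h2⟩
    rw [mem_recurEvent] at h1 h2
    rw [Set.mem_preimage, cylinder_append]
    refine ⟨?_, ?_⟩
    · rw [mem_cylinder_trunc]
      intro n hn
      rw [shift_iterate_apply, h1 n (by omega)]
    · rw [Set.mem_preimage, mem_cylinder_trunc, length_trunc]
      intro n hn
      rw [shift_iterate_apply, shift_iterate_apply, ← add_assoc,
        h2 n (hn.trans_le (hmono (Nat.le_add_right _ _)))]
  calc μ.real (recurEvent j l k ∩ recurEvent j l (k + s))
      ≤ μ.real (shift^[k] ⁻¹' cylinder (trunc j s ++ trunc j (l k))) := measureReal_mono hsub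
    _ = μ.real (cylinder (trunc j s ++ trunc j (l k))) := by
      rw [measureReal_def, (hμ.iterate k).measure_preimage
        (measurableSet_cylinder _).nullMeasurableSet, measureReal_def]
    _ ≤ K * θ ^ s * μ.real (cylinder (trunc j (l k))) := by
      simpa using hup (trunc j s) (trunc j (l k))
    _ = _ := by rw [measureReal_def, measureReal_def, measure_recurEvent hμ]

/-- Once the word at time $k$ is complete, the future is quasi-independent of it. The cutoff $N$
makes the absence of later events depend on finitely many letters. -/
theorem mul_measureReal_recurEvent_le [IsFiniteMeasure μ] (hμ : MeasurePreserving shift μ μ)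
    (hmono : Monotone l) {c : ℝ} (hc0 : 0 ≤ c) (hc : ∀ q r : List (Fin m),
      c * μ.real (cylinder q) * μ.real (cylinder r) ≤ μ.real (cylinder (q ++ r)))
    {a k : ℕ} (hk : a ≤ k) (N : ℕ) :
    c * μ.real {i | ∀ k', a ≤ k' → i ∉ recurEvent j l k'} * μ.real (recurEvent j l k) ≤
      μ.real (recurEvent j l k ∩ {i | ∀ k', k + l k ≤ k' → k' ≤ N → i ∉ recurEvent j l k'}) := by
  set n := k + l k with hn
  have hH : μ.real {i | ∀ k', a ≤ k' → i ∉ recurEvent j l k'} ≤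
      μ.real (noRecurrence j l n N) := by
    rw [measureReal_def (s := noRecurrence j l n N), ← (hμ.iterate n).measure_preimage
      (measurableSet_noRecurrence n N).nullMeasurableSet]
    refine measureReal_mono fun i hi => ?_
    rw [Set.mem_preimage, mem_preimage_noRecurrence]
    exact fun k' hk' _ => hi k' (by omega)
  have h1 := mul_measureReal_le_measureReal_cylinder_inter hc (trunc j (l k))
    (measurableSet_noRecurrence (j := j) n N) fun x y h hx => noRecurrence_congr hmono h hx
  have h2 : recurEvent j l k ∩ {i | ∀ k', n ≤ k' → k' ≤ N → i ∉ recurEvent j l k'} =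
      shift^[k] ⁻¹' (cylinder (trunc j (l k)) ∩
        shift^[(trunc j (l k)).length] ⁻¹' noRecurrence j l n N) := by
    ext i
    rw [Set.preimage_inter, Set.mem_inter_iff, Set.mem_inter_iff, Set.mem_preimage,
      Set.mem_preimage, Set.mem_preimage, length_trunc, ← Function.iterate_add_apply, add_comm (l k) k, ← hn,
      mem_preimage_noRecurrence]
    rfl
  have h3 : μ.real (shift^[k] ⁻¹' (cylinder (trunc j (l k)) ∩
      shift^[(trunc j (l k)).length] ⁻¹' noRecurrence j l n N)) = μ.real (cylinder (trunc j (l k)) ∩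
        shift^[(trunc j (l k)).length] ⁻¹' noRecurrence j l n N) := by
    rw [measureReal_def, (hμ.iterate k).measure_preimage, measureReal_def]
    exact ((measurableSet_cylinder _).inter ((measurable_shift.iterate _)
      (measurableSet_noRecurrence n N))).nullMeasurableSet
  rw [h2, h3]
  refine le_trans ?_ h1
  rw [measureReal_def (s := recurEvent j l k), measure_recurEvent hμ, ← measureReal_def,
    mul_right_comm]
  gcongr

theorem measure_recurringSet_eq_one [IsProbabilityMeasure μ] (hμ : MeasurePreserving shift μ μ)
    (hmono : Monotone l) {c K θ : ℝ} (hc0 : 0 < c) (hK : 0 ≤ K) (hθ : 0 ≤ θ) (hθ1 : θ < 1)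
    (hc : ∀ q r : List (Fin m),
      c * μ.real (cylinder q) * μ.real (cylinder r) ≤ μ.real (cylinder (q ++ r)))
    (hup : ∀ q r : List (Fin m),
      μ.real (cylinder (q ++ r)) ≤ K * θ ^ q.length * μ.real (cylinder r))
    (hdiv : ¬ Summable fun k => μ.real (recurEvent j l k)) :
    μ (recurringSet j l) = 1 := by
  rw [← prob_compl_eq_zero_iff (measurableSet_recurringSet j l)]
  by_contra hne
  apply hdiv
  set G : ℕ → Set (ℕ → Fin m) := fun a => {i | ∀ k', a ≤ k' → i ∉ recurEvent j l k'} with hG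
  obtain ⟨a, ha⟩ : ∃ a, μ (G a) ≠ 0 := by
    by_contra! hall
    refine hne (measure_mono_null (fun i hi => ?_) (measure_iUnion_null hall))
    rw [Set.mem_compl_iff, mem_recurringSet, not_frequently, eventually_atTop] at hi
    exact Set.mem_iUnion.2 hi
  set v := μ.real (G a) with hv
  have hvpos : 0 < v := ENNReal.toReal_pos ha (measure_ne_top _ _)
  -- Overlaps at distance at least $L$ may use up only half of the lower bound $cv$.
  obtain ⟨L, hL0, hL⟩ : ∃ L : ℕ, 0 < L ∧ K * θ ^ L / (1 - θ) ≤ c * v / 2 := by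
    have h0 : Tendsto (fun L : ℕ => K * θ ^ L / (1 - θ)) atTop (𝓝 0) := by
      simpa using ((tendsto_pow_atTop_nhds_zero_of_lt_one hθ hθ1).const_mul K).div_const (1 - θ)
    obtain ⟨L, hL1, hL2⟩ := ((h0.eventually_le_const (by positivity : 0 < c * v / 2)).and
      (eventually_gt_atTop 0)).exists
    exact ⟨L, hL2, hL1⟩
  -- Here $k$ is the last occurrence up to $N$ in its residue class mod $L$; distinct $k\le N$ in
  -- one class give disjoint sets.
  let F : ℕ → ℕ → Set (ℕ → Fin m) := fun N k => recurEvent j l k ∩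
    {i | ∀ k', k' % L = k % L → k < k' → k' ≤ N → i ∉ recurEvent j l k'}
  have hFm : ∀ N k, MeasurableSet (F N k) := fun N k => by
    refine (measurableSet_recurEvent j l k).inter ?_
    simp only [Set.ofPred_forall]
    exact MeasurableSet.iInter fun k' => MeasurableSet.iInter fun _ => MeasurableSet.iInter fun _ =>
      MeasurableSet.iInter fun _ => (measurableSet_recurEvent j l k').compl
  have hF : ∀ N k, a ≤ k → c * v / 2 * μ.real (recurEvent j l k) ≤ μ.real (F N k) := by
    intro N k hk
    set P := recurEvent j l k ∩ {i | ∀ k', k + l k ≤ k' → k' ≤ N → i ∉ recurEvent j l k'} with hP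
    set U := ⋃ s ∈ Finset.Ico L (l k), recurEvent j l k ∩ recurEvent j l (k + s) with hU
    have h1 : c * v * μ.real (recurEvent j l k) ≤ μ.real P :=
      mul_measureReal_recurEvent_le hμ hmono hc0.le hc hk N
    have h2 : μ.real U ≤ c * v / 2 * μ.real (recurEvent j l k) := by
      calc μ.real U ≤ ∑ s ∈ Finset.Ico L (l k),
            μ.real (recurEvent j l k ∩ recurEvent j l (k + s)) :=
            measureReal_biUnion_finset_le _ _
        _ ≤ ∑ s ∈ Finset.Ico L (l k), K * θ ^ s * μ.real (recurEvent j l k) :=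
            Finset.sum_le_sum fun s hs => measureReal_recurEvent_inter_le hμ hmono hup
              (Finset.mem_Ico.1 hs).2
        _ = K * (∑ s ∈ Finset.Ico L (l k), θ ^ s) * μ.real (recurEvent j l k) := by
            rw [Finset.mul_sum, Finset.sum_mul]
        _ ≤ K * (θ ^ L / (1 - θ)) * μ.real (recurEvent j l k) := by
            gcongr
            exact geom_sum_Ico_le_of_lt_one hθ hθ1
        _ ≤ _ := by
            rw [← mul_div_assoc]
            gcongr
    have h3 : P ⊆ F N k ∪ U := by
      rintro i ⟨hi1, hi2⟩
      by_cases hi : i ∈ U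
      · exact Or.inr hi
      -- A later event in the class either lies past $k+\ell_k$, excluded by `P`, or overlaps at a
      -- positive multiple of $L$, excluded since `i ∉ U`.
      refine Or.inl ⟨hi1, fun k' hmod hlt hN hk' => ?_⟩
      rcases le_or_gt (k + l k) k' with h | h
      · exact hi2 k' h hN hk'
      · obtain ⟨s, rfl⟩ := Nat.exists_eq_add_of_lt hlt
        refine hi (Set.mem_biUnion (x := s + 1) (Finset.mem_coe.2 (Finset.mem_Ico.2 ⟨?_, ?_⟩))
          ⟨hi1, by simpa only [add_assoc] using hk'⟩)
        · have h4 : (k + (s + 1)) % L = (k + 0) % L := by simpa only [add_assoc, add_zero] using hmod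
          exact Nat.le_of_dvd (Nat.succ_pos s) ((Nat.modEq_zero_iff_dvd).1
            (Nat.ModEq.add_left_cancel' k h4))
        · omega
    have h4 : μ.real P ≤ μ.real (F N k) + μ.real U :=
      (measureReal_mono h3).trans (measureReal_union_le _ _)
    linarith
  have hsum : ∀ N r, ∑ k ∈ (Finset.Ico a N).filter (fun k => k % L = r),
      μ.real (recurEvent j l k) ≤ 2 / (c * v) := by
    intro N r
    have h1 : ∑ k ∈ (Finset.Ico a N).filter (fun k => k % L = r), μ.real (F N k) ≤ 1 := by
      rw [← measureReal_biUnion_finset _ fun k _ => hFm N k]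
      · exact measureReal_le_one
      · have key : ∀ k k', k % L = r → k' % L = r → k' < N → k < k' →
            Disjoint (F N k) (F N k') := fun k k' h h' hN hlt =>
          Set.disjoint_left.2 fun i hi hi' => hi.2 k' (h'.trans h.symm) hlt hN.le hi'.1
        intro k hk k' hk' hne
        simp only [Finset.coe_filter, Finset.mem_Ico, Set.mem_ofPred_eq] at hk hk'
        rcases lt_or_gt_of_ne hne with h | h
        · exact key k k' hk.2 hk'.2 hk'.1.2 h
        · exact (key k' k hk'.2 hk.2 hk.1.2 h).symm
    have h2 : c * v / 2 * ∑ k ∈ (Finset.Ico a N).filter (fun k => k % L = r),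
        μ.real (recurEvent j l k) ≤ 1 := by
      rw [Finset.mul_sum]
      refine (Finset.sum_le_sum fun k hk => hF N k ?_).trans h1
      exact (Finset.mem_Ico.1 (Finset.mem_filter.1 hk).1).1
    rw [le_div_iff₀ (by positivity)]
    linarith
  have htail : ∀ N, ∑ k ∈ Finset.Ico a N, μ.real (recurEvent j l k) ≤ L * (2 / (c * v)) := by
    intro N
    rw [← Finset.sum_fiberwise_of_maps_to (t := Finset.range L) (g := fun k => k % L)
      fun k _ => Finset.mem_range.2 (Nat.mod_lt k hL0)]
    calc _ ≤ ∑ r ∈ Finset.range L, 2 / (c * v) := Finset.sum_le_sum fun r _ => hsum N r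
      _ = _ := by simp
  refine summable_of_sum_range_le (c := a + L * (2 / (c * v))) (fun _ => measureReal_nonneg) ?_
  intro n
  calc ∑ k ∈ Finset.range n, μ.real (recurEvent j l k)
      ≤ ∑ k ∈ Finset.range (max a n), μ.real (recurEvent j l k) :=
        Finset.sum_le_sum_of_subset_of_nonneg (by simp) fun _ _ _ => measureReal_nonneg
    _ = ∑ k ∈ Finset.range a, μ.real (recurEvent j l k) +
        ∑ k ∈ Finset.Ico a (max a n), μ.real (recurEvent j l k) :=
        (Finset.sum_range_add_sum_Ico _ (le_max_left _ _)).symm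
    _ ≤ a + L * (2 / (c * v)) := by
        gcongr
        · calc _ ≤ ∑ k ∈ Finset.range a, (1 : ℝ) := Finset.sum_le_sum fun _ _ => measureReal_le_one
            _ = a := by simp
        · exact htail _

end Divergence

/-! ### The projection and its dependence on the translations -/

section Projection

variable {T : Fin m → Module.End ℝ (EuclideanSpace ℝ (Fin d))} {ρ : ℝ}
  {a : Fin m → EuclideanSpace ℝ (Fin d)}

theorem wordMap_append (q r : List (Fin m)) : wordMap T (q ++ r) = wordMap T q * wordMap T r := by
  simp [wordMap]

theorem norm_wordMap_apply_le (hρ0 : 0 ≤ ρ) (hρ : ∀ i x, ‖T i x‖ ≤ ρ * ‖x‖) (q : List (Fin m))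
    (x : EuclideanSpace ℝ (Fin d)) : ‖wordMap T q x‖ ≤ ρ ^ q.length * ‖x‖ := by
  induction q with
  | nil => simp [wordMap]
  | cons i q ih =>
    calc ‖wordMap T (i :: q) x‖ = ‖T i (wordMap T q x)‖ := by simp [wordMap]
      _ ≤ ρ * (ρ ^ q.length * ‖x‖) := (hρ _ _).trans (mul_le_mul_of_nonneg_left ih hρ0)
      _ = _ := by rw [List.length_cons, pow_succ]; ring

theorem wordMap_injective (hbij : ∀ i, Function.Bijective (T i)) (q : List (Fin m)) :
    Function.Injective (wordMap T q) := by
  induction q with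
  | nil => exact fun x y h => by simpa [wordMap] using h
  | cons i q ih =>
    have : ⇑(wordMap T (i :: q)) = T i ∘ wordMap T q := by ext; simp [wordMap]
    rw [this]
    exact (hbij i).1.comp ih

theorem wordAffine_eq (q : List (Fin m)) (x : EuclideanSpace ℝ (Fin d)) :
    wordAffine T a q x = wordMap T q x + wordAffine T a q 0 := by
  induction q with
  | nil => simp [wordMap, wordAffine]
  | cons i q ih =>
    have h : ∀ z, wordAffine T a (i :: q) z = T i (wordAffine T a q z) + a i := fun _ => rfl
    rw [h, h, ih]
    simp [wordMap, add_assoc]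

theorem wordAffine_append (q r : List (Fin m)) (x : EuclideanSpace ℝ (Fin d)) :
    wordAffine T a (q ++ r) x = wordAffine T a q (wordAffine T a r x) := by
  simp [wordAffine]

theorem trunc_add (i : ℕ → Fin m) (k n : ℕ) :
    trunc i (k + n) = trunc i k ++ trunc (shift^[k] i) n := by
  simp [trunc, List.ofFn_add, shift_iterate_apply]

theorem wordAffine_trunc_zero (i : ℕ → Fin m) (n : ℕ) :
    wordAffine T a (trunc i n) 0 = ∑ k ∈ Finset.range n, wordMap T (trunc i k) (a (i k)) := by
  induction n with
  | zero => simp [trunc, wordAffine]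
  | succ n ih =>
    rw [trunc_add, wordAffine_append, wordAffine_eq, ih, Finset.sum_range_succ, add_comm]
    congr 2
    simp [trunc, wordAffine, shift_iterate_apply]

theorem norm_term_le (hρ0 : 0 ≤ ρ) (hρ : ∀ i x, ‖T i x‖ ≤ ρ * ‖x‖) (i : ℕ → Fin m) (k : ℕ) :
    ‖wordMap T (trunc i k) (a (i k))‖ ≤ ρ ^ k * ‖a (i k)‖ := by
  simpa using norm_wordMap_apply_le hρ0 hρ (trunc i k) (a (i k))

theorem norm_term_le' (hρ0 : 0 ≤ ρ) (hρ : ∀ i x, ‖T i x‖ ≤ ρ * ‖x‖) (i : ℕ → Fin m) (k : ℕ) :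
    ‖wordMap T (trunc i k) (a (i k))‖ ≤ ρ ^ k * ‖a‖ :=
  (norm_term_le hρ0 hρ i k).trans
    (mul_le_mul_of_nonneg_left (norm_le_pi_norm a _) (pow_nonneg hρ0 k))

theorem hasSum_proj (hρ0 : 0 ≤ ρ) (hρ1 : ρ < 1) (hρ : ∀ i x, ‖T i x‖ ≤ ρ * ‖x‖)
    (a : Fin m → EuclideanSpace ℝ (Fin d)) (i : ℕ → Fin m) :
    HasSum (fun k => wordMap T (trunc i k) (a (i k))) (proj T a i) := by
  have hs : Summable fun k => wordMap T (trunc i k) (a (i k)) :=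
    Summable.of_norm_bounded ((summable_geometric_of_lt_one hρ0 hρ1).mul_right ‖a‖)
      fun k => norm_term_le' hρ0 hρ i k
  have : proj T a i = ∑' k, wordMap T (trunc i k) (a (i k)) := by
    refine Tendsto.limUnder_eq ?_
    simpa only [wordAffine_trunc_zero] using hs.hasSum.tendsto_sum_nat
  rw [this]
  exact hs.hasSum

theorem tendsto_proj (hρ0 : 0 ≤ ρ) (hρ1 : ρ < 1) (hρ : ∀ i x, ‖T i x‖ ≤ ρ * ‖x‖)
    (a : Fin m → EuclideanSpace ℝ (Fin d)) (i : ℕ → Fin m) :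
    Tendsto (fun k => wordAffine T a (trunc i k) 0) atTop (𝓝 (proj T a i)) := by
  simpa only [wordAffine_trunc_zero] using (hasSum_proj hρ0 hρ1 hρ a i).tendsto_sum_nat

theorem norm_proj_le (hρ0 : 0 ≤ ρ) (hρ1 : ρ < 1 / 2) (hρ : ∀ i x, ‖T i x‖ ≤ ρ * ‖x‖)
    (a : Fin m → EuclideanSpace ℝ (Fin d)) (i : ℕ → Fin m) : ‖proj T a i‖ ≤ 2 * ‖a‖ := by
  have hρ2 : ρ < 1 := by linarith
  rw [← (hasSum_proj hρ0 hρ2 hρ a i).tsum_eq]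
  refine (tsum_of_norm_bounded ((hasSum_geometric_of_lt_one hρ0 hρ2).mul_right ‖a‖)
    fun k => norm_term_le' hρ0 hρ i k).trans ?_
  gcongr
  rw [inv_le_comm₀ (by linarith) (by norm_num)]
  linarith

theorem proj_eq_wordAffine (hρ0 : 0 ≤ ρ) (hρ1 : ρ < 1) (hρ : ∀ i x, ‖T i x‖ ≤ ρ * ‖x‖)
    (a : Fin m → EuclideanSpace ℝ (Fin d)) (i : ℕ → Fin m) (k : ℕ) :
    proj T a i = wordAffine T a (trunc i k) (proj T a (shift^[k] i)) := by
  have h1 := (tendsto_proj hρ0 hρ1 hρ a i).comp (tendsto_add_atTop_nat k)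
  have h2 := tendsto_proj hρ0 hρ1 hρ a (shift^[k] i)
  have hc : Continuous (wordAffine T a (trunc i k)) := by
    rw [show wordAffine T a (trunc i k) = fun x => wordMap T (trunc i k) x +
      wordAffine T a (trunc i k) 0 from funext fun x => wordAffine_eq _ x]
    exact (LinearMap.continuous_of_finiteDimensional _).add continuous_const
  refine tendsto_nhds_unique h1 (((hc.tendsto _).comp h2).congr fun n => ?_)
  simp only [Function.comp_apply]
  rw [add_comm n k, trunc_add, wordAffine_append]

theorem continuous_proj (hρ0 : 0 ≤ ρ) (hρ1 : ρ < 1) (hρ : ∀ i x, ‖T i x‖ ≤ ρ * ‖x‖)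
    (a : Fin m → EuclideanSpace ℝ (Fin d)) : Continuous (proj T a) := by
  rw [show proj T a = fun i => ∑' k, wordMap T (trunc i k) (a (i k)) from
    funext fun i => (hasSum_proj hρ0 hρ1 hρ a i).tsum_eq.symm]
  refine continuous_tsum (fun k => ?_)
    ((summable_geometric_of_lt_one hρ0 hρ1).mul_right ‖a‖) fun k i => norm_term_le' hρ0 hρ i k
  exact (continuous_of_discreteTopology (f := fun p : (Fin k → Fin m) × Fin m =>
    wordMap T (List.ofFn p.1) (a p.2))).comp
    (Continuous.prodMk (continuous_pi fun n : Fin k => continuous_apply (n : ℕ))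
      (continuous_apply k))

/-- Joint measurability is what Fubini needs for the collision sets. -/
theorem measurable_proj (hρ0 : 0 ≤ ρ) (hρ1 : ρ < 1) (hρ : ∀ i x, ‖T i x‖ ≤ ρ * ‖x‖) :
    Measurable fun p : (ℕ → Fin m) × (Fin m → EuclideanSpace ℝ (Fin d)) => proj T p.2 p.1 := by
  refine measurable_of_tendsto_metrizable (f := fun k p => wordAffine T p.2 (trunc p.1 k) 0)
    (fun k => ?_) (tendsto_pi_nhds.2 fun p => tendsto_proj hρ0 hρ1 hρ p.2 p.1)
  simp only [wordAffine_trunc_zero]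
  refine Finset.measurable_sum _ fun n _ => ?_
  have h : Measurable fun p : ((Fin n → Fin m) × Fin m) × (Fin m → EuclideanSpace ℝ (Fin d)) =>
      wordMap T (List.ofFn p.1.1) (p.2 p.1.2) :=
    measurable_from_prod_countable_right fun w =>
      (LinearMap.continuous_of_finiteDimensional
        (wordMap T (List.ofFn w.1))).measurable.comp (measurable_pi_apply w.2)
  refine h.comp (Measurable.prodMk (Measurable.prodMk ?_ ?_) measurable_snd)
  · exact measurable_pi_lambda _ fun k => (measurable_pi_apply _).comp measurable_fst
  · exact (measurable_pi_apply _).comp measurable_fst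

theorem proj_add (hρ0 : 0 ≤ ρ) (hρ1 : ρ < 1) (hρ : ∀ i x, ‖T i x‖ ≤ ρ * ‖x‖)
    (a b : Fin m → EuclideanSpace ℝ (Fin d)) (i : ℕ → Fin m) :
    proj T (a + b) i = proj T a i + proj T b i := by
  refine (hasSum_proj hρ0 hρ1 hρ (a + b) i).unique ?_
  simpa using (hasSum_proj hρ0 hρ1 hρ a i).add (hasSum_proj hρ0 hρ1 hρ b i)

theorem proj_smul (hρ0 : 0 ≤ ρ) (hρ1 : ρ < 1) (hρ : ∀ i x, ‖T i x‖ ≤ ρ * ‖x‖)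
    (c : ℝ) (a : Fin m → EuclideanSpace ℝ (Fin d)) (i : ℕ → Fin m) :
    proj T (c • a) i = c • proj T a i := by
  refine (hasSum_proj hρ0 hρ1 hρ (c • a) i).unique ?_
  simpa using (hasSum_proj hρ0 hρ1 hρ a i).const_smul c

theorem exists_ratio (hhalf : ∀ i, (T i).singularValues 0 < 1 / 2) :
    ∃ ρ : ℝ, 0 ≤ ρ ∧ ρ < 1 / 2 ∧ ∀ i x, ‖T i x‖ ≤ ρ * ‖x‖ := by
  rcases isEmpty_or_nonempty (Fin m) with hm | hm
  · exact ⟨0, le_rfl, by norm_num, fun i => hm.elim i⟩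
  · obtain ⟨i₀, hi₀⟩ := Finite.exists_max fun i => (T i).singularValues 0
    exact ⟨(T i₀).singularValues 0, (T i₀).singularValues_nonneg 0, hhalf i₀, fun i x =>
      ((T i).norm_apply_le_singularValues_zero x).trans
        (mul_le_mul_of_nonneg_right (hi₀ i) (norm_nonneg x))⟩

end Projection

end SelfAffine

/-! ### Transversality -/

/-- The preimage of the unit ball lies in the ball of radius $K$; comparing their volumes bounds
$|\det\Phi|^{-1}$. -/
theorem LinearMap.volume_preimage_le_of_norm_le {V : Type*} [NormedAddCommGroup V]
    [NormedSpace ℝ V] [FiniteDimensional ℝ V] [MeasurableSpace V] [BorelSpace V] (ν : Measure V)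
    [ν.IsAddHaarMeasure] {K : ℝ} (hK : 0 < K) (Φ : V →ₗ[ℝ] V) (h : ∀ x, ‖x‖ ≤ K * ‖Φ x‖)
    (S : Set V) : ν (Φ ⁻¹' S) ≤ ENNReal.ofReal (K ^ Module.finrank ℝ V) * ν S := by
  have hinj : LinearMap.ker Φ = ⊥ := LinearMap.ker_eq_bot'.2 fun x hx => by
    have := h x
    rw [hx, norm_zero, mul_zero] at this
    exact norm_le_zero_iff.1 this
  have hdet : LinearMap.det Φ ≠ 0 := fun h0 =>
    (LinearMap.bot_lt_ker_of_det_eq_zero h0).ne' hinj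
  rw [Measure.addHaar_preimage_linearMap ν hdet]
  gcongr ?_ * _
  have hpos : ν (Metric.ball 0 1) ≠ 0 := (Metric.measure_ball_pos ν 0 one_pos).ne'
  have hfin : ν (Metric.ball 0 1) ≠ ⊤ := measure_ball_lt_top.ne
  have h1 : Φ ⁻¹' Metric.ball 0 1 ⊆ Metric.ball 0 K := by
    intro x hx
    simp only [Set.mem_preimage, mem_ball_zero_iff] at hx ⊢
    calc ‖x‖ ≤ K * ‖Φ x‖ := h x
      _ < K * 1 := by gcongr
      _ = K := mul_one K
  have h2 := measure_mono (μ := ν) h1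
  rw [Measure.addHaar_preimage_linearMap ν hdet, Measure.addHaar_ball_of_pos ν 0 hK] at h2
  exact (ENNReal.mul_le_mul_iff_left hpos hfin).1 h2

namespace SelfAffine

variable {d m : ℕ}

section Transversality

variable {T : Fin m → Module.End ℝ (EuclideanSpace ℝ (Fin d))} {ρ : ℝ}

/-- The total size of the coefficients of `a_γ` in the series for `π_a(x) - a_{x_1}`. -/
noncomputable def tailWeight (ρ : ℝ) (x : ℕ → Fin m) (γ : Fin m) : ℝ :=
  ∑' k : ℕ, if x (k + 1) = γ then ρ ^ (k + 1) else 0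

theorem summable_tailWeight (hρ0 : 0 ≤ ρ) (hρ1 : ρ < 1) (x : ℕ → Fin m) (γ : Fin m) :
    Summable fun k : ℕ => if x (k + 1) = γ then ρ ^ (k + 1) else 0 := by
  refine Summable.of_nonneg_of_le (fun k => ?_) (fun k => ?_)
    ((summable_nat_add_iff 1).2 (summable_geometric_of_lt_one hρ0 hρ1))
  · split_ifs
    · positivity
    · exact le_rfl
  · split_ifs
    · exact le_rfl
    · positivity

theorem tailWeight_nonneg (hρ0 : 0 ≤ ρ) (x : ℕ → Fin m) (γ : Fin m) : 0 ≤ tailWeight ρ x γ :=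
  tsum_nonneg fun k => by split_ifs <;> positivity

theorem sum_tailWeight (hρ0 : 0 ≤ ρ) (hρ1 : ρ < 1) (x : ℕ → Fin m) :
    ∑ γ, tailWeight ρ x γ = ρ / (1 - ρ) := by
  unfold tailWeight
  rw [← Summable.tsum_finsetSum fun γ _ => summable_tailWeight hρ0 hρ1 x γ]
  simp only [Finset.sum_ite_eq, Finset.mem_univ, if_true, pow_succ]
  rw [tsum_mul_right, tsum_geometric_of_lt_one hρ0 hρ1, div_eq_inv_mul]

theorem norm_proj_sub_le (hρ0 : 0 ≤ ρ) (hρ1 : ρ < 1) (hρ : ∀ i x, ‖T i x‖ ≤ ρ * ‖x‖)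
    (a : Fin m → EuclideanSpace ℝ (Fin d)) (x : ℕ → Fin m) :
    ‖proj T a x - a (x 0)‖ ≤ ∑ γ, tailWeight ρ x γ * ‖a γ‖ := by
  have h1 := (hasSum_nat_add_iff' 1).2 (hasSum_proj hρ0 hρ1 hρ a x)
  simp only [Finset.sum_range_one] at h1
  have h0 : wordMap T (trunc x 0) (a (x 0)) = a (x 0) := by simp [trunc, wordMap]
  rw [h0] at h1
  have h2 : HasSum (fun k : ℕ => ∑ γ, (if x (k + 1) = γ then ρ ^ (k + 1) else 0) * ‖a γ‖)
      (∑ γ, tailWeight ρ x γ * ‖a γ‖) :=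
    hasSum_sum fun γ _ => (summable_tailWeight hρ0 hρ1 x γ).hasSum.mul_right _
  rw [← h1.tsum_eq]
  refine tsum_of_norm_bounded h2 fun k => ?_
  simpa using norm_term_le hρ0 hρ x (k + 1)

/-- Since $a_e$ occurs on the right with weight at most $\kappa<1$, it can be absorbed on the left:
with $b$ the updated vector, $(1-\kappa)\|a_e\|\le(2+2\kappa)\|b\|\le4\|b\|$. -/
theorem norm_le_of_update {V : Type*} [NormedAddCommGroup V] {κ : ℝ} (hκ0 : 0 ≤ κ) (hκ1 : κ < 1)
    {u : Fin m → ℝ} (hu : ∀ γ, 0 ≤ u γ) (hsum : ∑ γ, u γ = 2 * κ) {e f : Fin m} (hef : e ≠ f)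
    (hue : u e ≤ κ) (a : Fin m → V) (v : V)
    (h : ‖a e‖ ≤ ‖v‖ + ‖a f‖ + ∑ γ, u γ * ‖a γ‖) :
    ‖a‖ ≤ 4 / (1 - κ) * ‖Function.update a e v‖ := by
  set b := Function.update a e v with hb
  have hb1 : ∀ γ, γ ≠ e → ‖a γ‖ ≤ ‖b‖ := fun γ hγ => by
    have := norm_le_pi_norm b γ
    rwa [hb, Function.update_of_ne hγ] at this
  have hb2 : ‖v‖ ≤ ‖b‖ := by
    have := norm_le_pi_norm b e
    rwa [hb, Function.update_self] at this
  have h1κ : 0 < 1 - κ := by linarith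
  have hs : ∑ γ, u γ * ‖a γ‖ ≤ κ * ‖a e‖ + 2 * κ * ‖b‖ := by
    rw [← Finset.add_sum_erase _ _ (Finset.mem_univ e)]
    refine add_le_add (by gcongr) ?_
    calc ∑ γ ∈ Finset.univ.erase e, u γ * ‖a γ‖
        ≤ ∑ γ ∈ Finset.univ.erase e, u γ * ‖b‖ := Finset.sum_le_sum fun γ hγ =>
          mul_le_mul_of_nonneg_left (hb1 γ (Finset.ne_of_mem_erase hγ)) (hu γ)
      _ ≤ ∑ γ, u γ * ‖b‖ := Finset.sum_le_sum_of_subset_of_nonneg (Finset.erase_subset _ _)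
          fun γ _ _ => mul_nonneg (hu γ) (norm_nonneg _)
      _ = 2 * κ * ‖b‖ := by rw [← Finset.sum_mul, hsum]
  have hf := hb1 f hef.symm
  have hbn := norm_nonneg b
  have hmain : ‖a e‖ ≤ 4 / (1 - κ) * ‖b‖ := by
    rw [div_mul_eq_mul_div, le_div_iff₀ h1κ]
    nlinarith
  refine (pi_norm_le_iff_of_nonneg (by positivity)).2 fun γ => ?_
  by_cases hγ : γ = e
  · rw [hγ]; exact hmain
  · refine (hb1 γ hγ).trans (le_mul_of_one_le_left hbn ?_)
    rw [le_div_iff₀ h1κ]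
    linarith

/-- The two tails have total weight $2\kappa$ with $\kappa=\rho/(1-\rho)$, and $\kappa<1$ exactly
because $\rho<\frac12$. So one of the distinct letters $x_1,y_1$ has tail weight at most $\kappa$
and can be solved for from $\pi_a(x)-\pi_a(y)$ and the other translations. -/
theorem exists_norm_le_update_proj_sub (hρ0 : 0 ≤ ρ) (hρ1 : ρ < 1 / 2)
    (hρ : ∀ i x, ‖T i x‖ ≤ ρ * ‖x‖) {x y : ℕ → Fin m} (hxy : x 0 ≠ y 0) :
    ∃ e, ∀ a : Fin m → EuclideanSpace ℝ (Fin d),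
      ‖a‖ ≤ 4 / (1 - ρ / (1 - ρ)) * ‖Function.update a e (proj T a x - proj T a y)‖ := by
  have hρ2 : ρ < 1 := by linarith
  have hκ0 : 0 ≤ ρ / (1 - ρ) := div_nonneg hρ0 (by linarith)
  have hκ1 : ρ / (1 - ρ) < 1 := by rw [div_lt_one (by linarith)]; linarith
  set u : Fin m → ℝ := fun γ => tailWeight ρ x γ + tailWeight ρ y γ with hu
  have hu0 : ∀ γ, 0 ≤ u γ := fun γ =>
    add_nonneg (tailWeight_nonneg hρ0 x γ) (tailWeight_nonneg hρ0 y γ)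
  have hsum : ∑ γ, u γ = 2 * (ρ / (1 - ρ)) := by
    rw [hu, Finset.sum_add_distrib, sum_tailWeight hρ0 hρ2, sum_tailWeight hρ0 hρ2]
    ring
  have hL : ∀ a : Fin m → EuclideanSpace ℝ (Fin d),
      ‖(proj T a x - a (x 0)) - (proj T a y - a (y 0))‖ ≤ ∑ γ, u γ * ‖a γ‖ := fun a => by
    refine (norm_sub_le _ _).trans ?_
    simp only [hu, add_mul, Finset.sum_add_distrib]
    exact add_le_add (norm_proj_sub_le hρ0 hρ2 hρ a x) (norm_proj_sub_le hρ0 hρ2 hρ a y)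
  have htwo : u (x 0) + u (y 0) ≤ 2 * (ρ / (1 - ρ)) := by
    rw [← hsum, ← Finset.sum_pair hxy]
    exact Finset.sum_le_sum_of_subset_of_nonneg (Finset.subset_univ _) fun γ _ _ => hu0 γ
  rcases le_or_gt (u (x 0)) (ρ / (1 - ρ)) with hx | hx
  · refine ⟨x 0, fun a => norm_le_of_update hκ0 hκ1 hu0 hsum hxy hx a _ ?_⟩
    have h1 : a (x 0) = (proj T a x - proj T a y) + a (y 0) -
        ((proj T a x - a (x 0)) - (proj T a y - a (y 0))) := by abel
    calc ‖a (x 0)‖ = _ := congrArg norm h1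
      _ ≤ _ := (norm_sub_le _ _).trans (add_le_add (norm_add_le _ _) (hL a))
  · refine ⟨y 0, fun a => norm_le_of_update hκ0 hκ1 hu0 hsum hxy.symm (by linarith) a _ ?_⟩
    have h1 : a (y 0) = ((proj T a x - a (x 0)) - (proj T a y - a (y 0))) -
        (proj T a x - proj T a y) + a (x 0) := by abel
    calc ‖a (y 0)‖ = _ := congrArg norm h1
      _ ≤ _ := (norm_add_le _ _).trans (add_le_add_left (norm_sub_le _ _) _)
      _ ≤ _ := by linarith [hL a]

/-- Replacing the coordinate $a_e$ by $\pi_a(x)-\pi_a(y)$ is a linear change of variables with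
uniformly bounded inverse. In the new coordinates the set lies in a product with one factor `S ''
B'`, which contributes the determinant. -/
theorem volume_proj_sub_mem_le (hρ0 : 0 ≤ ρ) (hρ1 : ρ < 1 / 2)
    (hρ : ∀ i x, ‖T i x‖ ≤ ρ * ‖x‖) (s : ℝ) :
    ∃ M : ENNReal, M ≠ ⊤ ∧ ∀ (x y : ℕ → Fin m), x 0 ≠ y 0 →
      ∀ S : Module.End ℝ (EuclideanSpace ℝ (Fin d)),
      volume {a : Fin m → EuclideanSpace ℝ (Fin d) | a ∈ Metric.closedBall 0 s ∧
        proj T a x - proj T a y ∈ S '' Metric.closedBall 0 (4 * s)} ≤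
      M * ENNReal.ofReal |LinearMap.det S| := by
  classical
  have hρ2 : ρ < 1 := by linarith
  have hκ1 : ρ / (1 - ρ) < 1 := by rw [div_lt_one (by linarith)]; linarith
  set K := 4 / (1 - ρ / (1 - ρ)) with hK
  have hKpos : 0 < K := div_pos (by norm_num) (by linarith)
  set B := Metric.closedBall (0 : EuclideanSpace ℝ (Fin d)) s with hB
  set B' := Metric.closedBall (0 : EuclideanSpace ℝ (Fin d)) (4 * s) with hB'
  refine ⟨ENNReal.ofReal (K ^ Module.finrank ℝ (Fin m → EuclideanSpace ℝ (Fin d))) *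
    (volume B' * volume B ^ (m - 1)), ?_, fun x y hxy S => ?_⟩
  · exact ENNReal.mul_ne_top ENNReal.ofReal_ne_top (ENNReal.mul_ne_top measure_closedBall_lt_top.ne
      (ENNReal.pow_ne_top measure_closedBall_lt_top.ne))
  obtain ⟨e, he⟩ := exists_norm_le_update_proj_sub hρ0 hρ1 hρ hxy
  let Φ : (Fin m → EuclideanSpace ℝ (Fin d)) →ₗ[ℝ] (Fin m → EuclideanSpace ℝ (Fin d)) :=
    { toFun := fun a => Function.update a e (proj T a x - proj T a y)
      map_add' := fun a b => by
        rw [proj_add hρ0 hρ2 hρ, proj_add hρ0 hρ2 hρ, ← Function.update_add, add_sub_add_comm]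
      map_smul' := fun c a => by
        rw [proj_smul hρ0 hρ2 hρ, proj_smul hρ0 hρ2 hρ, RingHom.id_apply, ← Function.update_smul,
          smul_sub] }
  have hsub : {a : Fin m → EuclideanSpace ℝ (Fin d) | a ∈ Metric.closedBall 0 s ∧
      proj T a x - proj T a y ∈ S '' B'} ⊆
      Φ ⁻¹' (Set.univ.pi fun γ => if γ = e then S '' B' else B) := by
    rintro a ⟨ha1, ha2⟩ γ -
    change Function.update a e (proj T a x - proj T a y) γ ∈ _
    by_cases hγ : γ = e
    · subst hγ
      simpa using ha2
    · simp only [hγ, if_false, ne_eq, not_false_eq_true, Function.update_of_ne]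
      rw [mem_closedBall_zero_iff] at ha1
      exact mem_closedBall_zero_iff.2 ((norm_le_pi_norm a γ).trans ha1)
  refine (measure_mono hsub).trans ((Φ.volume_preimage_le_of_norm_le volume hKpos he _).trans ?_)
  rw [volume_pi_pi, ← Finset.mul_prod_erase _ _ (Finset.mem_univ e), if_pos rfl,
    Measure.addHaar_image_linearMap]
  have hprod : ∏ γ ∈ Finset.univ.erase e, volume (if γ = e then S '' B' else B) =
      volume B ^ (m - 1) := by
    rw [Finset.prod_congr rfl fun γ hγ => by rw [if_neg (Finset.ne_of_mem_erase hγ)]]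
    simp
  rw [hprod]
  exact le_of_eq (by ring)

end Transversality

end SelfAffine

/-- Evaluating the norm bound at the top singular vector gives this; it supplies the hypothesis of
`abs_det_le_phi` for word maps. -/
theorem LinearMap.singularValues_zero_le {E F : Type*} [NormedAddCommGroup E]
    [InnerProductSpace ℝ E] [FiniteDimensional ℝ E] [NormedAddCommGroup F] [InnerProductSpace ℝ F]
    [FiniteDimensional ℝ F] (U : E →ₗ[ℝ] F) {c : ℝ} (hc : 0 ≤ c) (h : ∀ x, ‖U x‖ ≤ c * ‖x‖) :
    U.singularValues 0 ≤ c := by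
  by_cases h0 : Module.finrank ℝ E ≤ 0
  · rwa [singularValues_of_finrank_le _ h0]
  push Not at h0
  set b := U.isSymmetric_adjoint_comp_self.eigenvectorBasis rfl with hb
  let k : Fin (Module.finrank ℝ E) := ⟨0, h0⟩
  refine le_of_sq_le_sq ?_ hc
  have h1 : ‖b k‖ = 1 := b.orthonormal.1 k
  have h2 : ‖U (b k)‖ ^ 2 ≤ c ^ 2 := by
    have := h (b k)
    rw [h1, mul_one] at this
    exact pow_le_pow_left₀ (norm_nonneg _) this 2
  refine le_trans ?_ h2
  rw [U.norm_sq_apply_eq_sum_singularValues rfl]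
  refine le_trans (le_of_eq ?_) (Finset.single_le_sum (fun i _ => by positivity)
    (Finset.mem_univ k))
  rw [← hb, real_inner_self_eq_norm_sq, h1]
  simp [k]

/-! ### Null images, collisions and conclusion -/

namespace SelfAffine

variable {d m : ℕ}

section Main

variable {T : Fin m → Module.End ℝ (EuclideanSpace ℝ (Fin d))} {ρ t : ℝ}
  {μ : Measure (ℕ → Fin m)} {j : ℕ → Fin m} {l : ℕ → ℕ}

/-- The image need not be measurable, so nullity of its preimage does not transfer directly. Compact
sets that nearly exhaust the complement of a null hull of the preimage have compact images disjoint
from $g(R)$. -/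
theorem map_image_eq_zero_of_subset_null {X Y : Type*} [TopologicalSpace X] [MeasurableSpace X]
    [BorelSpace X] [TopologicalSpace Y] [T2Space Y] [MeasurableSpace Y] [BorelSpace Y]
    {ν : Measure X} [IsFiniteMeasure ν] [ν.InnerRegularCompactLTTop] {g : X → Y}
    (hg : Continuous g) {R : Set X} (h : ν (g ⁻¹' (g '' R)) = 0) : ν.map g (g '' R) = 0 := by
  refine le_antisymm (le_of_forall_pos_le_add fun ε hε => ?_) zero_le
  set N := toMeasurable ν (g ⁻¹' (g '' R)) with hN
  have hN0 : ν N = 0 := (measure_toMeasurable _).trans h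
  obtain ⟨K, hKN, hK, hKε⟩ := (measurableSet_toMeasurable ν (g ⁻¹' (g '' R))).compl
    |>.exists_isCompact_lt_add (measure_ne_top ν _) hε.ne'
  have hKc := hK.image hg
  have hsub : g '' R ⊆ (g '' K)ᶜ := by
    rintro y hy ⟨x, hxK, rfl⟩
    exact hKN hxK (subset_toMeasurable _ _ hy)
  have hKm : MeasurableSet (g '' K) := hKc.measurableSet
  calc ν.map g (g '' R) ≤ ν.map g (g '' K)ᶜ := measure_mono hsub
    _ = ν (g ⁻¹' (g '' K))ᶜ := by
      rw [Measure.map_apply hg.measurable hKm.compl, Set.preimage_compl]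
    _ = ν Set.univ - ν (g ⁻¹' (g '' K)) := by
      rw [measure_compl (hg.measurable hKm) (measure_ne_top _ _)]
    _ ≤ 0 + ε := by
      rw [tsub_le_iff_right, zero_add]
      have h1 : ν Set.univ ≤ ν Nᶜ := by
        have := measure_univ_le_add_compl N (μ := ν)
        rwa [hN0, zero_add] at this
      have h2 : ν K ≤ ν (g ⁻¹' (g '' K)) := measure_mono (Set.subset_preimage_image g K)
      calc ν Set.univ ≤ ν K + ε := h1.trans hKε.le
        _ ≤ ν (g ⁻¹' (g '' K)) + ε := by gcongr
        _ = _ := add_comm _ _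

/-- A sequence that begins with the word `w`. -/
def extend (z : Fin m) (w : List (Fin m)) : ℕ → Fin m :=
  fun n => w.getD n z

theorem extend_mem_cylinder (z : Fin m) (w : List (Fin m)) : extend z w ∈ cylinder w := by
  rw [mem_cylinder_iff]
  intro n hn
  simp [extend, hn]

/-- The common translation cancels, leaving $T_{\mathbf w}$ of a difference of two projections, each
of norm at most $2s$. -/
theorem proj_sub_proj_mem_image (hρ0 : 0 ≤ ρ) (hρ1 : ρ < 1 / 2) (hρ : ∀ i x, ‖T i x‖ ≤ ρ * ‖x‖)
    {s : ℝ} {a : Fin m → EuclideanSpace ℝ (Fin d)} (ha : ‖a‖ ≤ s) {w : List (Fin m)}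
    {x y : ℕ → Fin m} (hx : x ∈ cylinder w) (hy : y ∈ cylinder w) :
    proj T a x - proj T a y ∈ wordMap T w '' Metric.closedBall 0 (4 * s) := by
  have hρ2 : ρ < 1 := by linarith
  have hx' : trunc x w.length = w := hx
  have hy' : trunc y w.length = w := hy
  refine ⟨proj T a (shift^[w.length] x) - proj T a (shift^[w.length] y), ?_, ?_⟩
  · rw [mem_closedBall_zero_iff]
    have h1 := norm_proj_le hρ0 hρ1 hρ a (shift^[w.length] x)
    have h2 := norm_proj_le hρ0 hρ1 hρ a (shift^[w.length] y)
    exact (norm_sub_le _ _).trans (by linarith)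
  · rw [proj_eq_wordAffine hρ0 hρ2 hρ a x w.length, proj_eq_wordAffine hρ0 hρ2 hρ a y w.length,
      hx', hy', wordAffine_eq, wordAffine_eq w (proj T a _), map_sub]
    abel

/-- The pairs `(x, a)` for which some cylinder `[r j|_{ℓ_k}]` with `|r| = k` that does not begin
with `x_1` comes, under `π_a`, as close to `π_a(x)` as its size allows for `|a| ≤ s`. -/
def collision (T : Fin m → Module.End ℝ (EuclideanSpace ℝ (Fin d))) (j : ℕ → Fin m) (l : ℕ → ℕ)
    (s : ℝ) (k : ℕ) : Set ((ℕ → Fin m) × (Fin m → EuclideanSpace ℝ (Fin d))) :=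
  {p | ∃ r : Fin k → Fin m, p.1 0 ≠ extend (j 0) (List.ofFn r ++ trunc j (l k)) 0 ∧
    proj T p.2 p.1 - proj T p.2 (extend (j 0) (List.ofFn r ++ trunc j (l k))) ∈
      wordMap T (List.ofFn r ++ trunc j (l k)) '' Metric.closedBall 0 (4 * s)}

theorem measurable_proj_left (hρ0 : 0 ≤ ρ) (hρ1 : ρ < 1) (hρ : ∀ i x, ‖T i x‖ ≤ ρ * ‖x‖)
    (y : ℕ → Fin m) : Measurable fun a : Fin m → EuclideanSpace ℝ (Fin d) => proj T a y := by
  have h1 : Measurable fun a : Fin m → EuclideanSpace ℝ (Fin d) => (y, a) :=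
    measurable_prodMk_left
  have h2 := (measurable_proj hρ0 hρ1 hρ).comp h1
  exact h2

theorem measurableSet_collision (hρ0 : 0 ≤ ρ) (hρ1 : ρ < 1) (hρ : ∀ i x, ‖T i x‖ ≤ ρ * ‖x‖)
    (s : ℝ) (k : ℕ) : MeasurableSet (collision T j l s k) := by
  have hU : collision T j l s k = ⋃ r : Fin k → Fin m,
      (fun p : (ℕ → Fin m) × (Fin m → EuclideanSpace ℝ (Fin d)) => p.1 0) ⁻¹'
        {extend (j 0) (List.ofFn r ++ trunc j (l k)) 0}ᶜ ∩
      (fun p : (ℕ → Fin m) × (Fin m → EuclideanSpace ℝ (Fin d)) =>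
        proj T p.2 p.1 - proj T p.2 (extend (j 0) (List.ofFn r ++ trunc j (l k)))) ⁻¹'
        (wordMap T (List.ofFn r ++ trunc j (l k)) '' Metric.closedBall 0 (4 * s)) := by
    ext p
    rw [Set.mem_iUnion]
    exact ⟨fun ⟨r, h1, h2⟩ => ⟨r, h1, h2⟩, fun ⟨r, h1, h2⟩ => ⟨r, h1, h2⟩⟩
  rw [hU]
  refine MeasurableSet.iUnion fun r => MeasurableSet.inter ?_ ?_
  · exact ((measurable_pi_apply 0).comp measurable_fst) (measurableSet_singleton _).compl
  · have hc : IsCompact (wordMap T (List.ofFn r ++ trunc j (l k)) ''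
        Metric.closedBall 0 (4 * s)) :=
      (isCompact_closedBall _ _).image (LinearMap.continuous_of_finiteDimensional _)
    have h2 := (measurable_proj_left hρ0 hρ1 hρ
      (extend (j 0) (List.ofFn r ++ trunc j (l k)))).comp
        (show Measurable (Prod.snd : (ℕ → Fin m) × (Fin m → EuclideanSpace ℝ (Fin d)) → _) from
          measurable_snd)
    have h3 := (measurable_proj hρ0 hρ1 hρ).sub h2
    exact h3 hc.measurableSet

theorem ae_not_frequently_collision (ht : t ∈ Set.Icc (0 : ℝ) d) (hμ : IsGibbsMeasure T t μ)
    (hzero : HasPressure T t 0) (hρ0 : 0 ≤ ρ) (hρ1 : ρ < 1 / 2)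
    (hρ : ∀ i x, ‖T i x‖ ≤ ρ * ‖x‖) (hsum : ∑' k, μ (cylinder (trunc j (l k))) ≠ ⊤) (s : ℝ)
    (x : ℕ → Fin m) :
    ∀ᵐ a ∂volume.restrict (Metric.closedBall (0 : Fin m → EuclideanSpace ℝ (Fin d)) s),
      ¬ ∃ᶠ k in atTop, (x, a) ∈ collision T j l s k := by
  have := hμ.isProbabilityMeasure
  obtain ⟨C, hC, hCb⟩ := hμ.exists_bounds hzero
  obtain ⟨M, hM, hMb⟩ := volume_proj_sub_mem_le hρ0 hρ1 hρ s
  have hdet : ∀ w, ENNReal.ofReal |LinearMap.det (wordMap T w)| ≤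
      ENNReal.ofReal C * μ (cylinder w) := fun w => by
    have h1 : (wordMap T w).singularValues 0 ≤ 1 :=
      (wordMap T w).singularValues_zero_le zero_le_one fun x =>
        (norm_wordMap_apply_le hρ0 hρ w x).trans (mul_le_mul_of_nonneg_right
          (pow_le_one₀ hρ0 (by linarith)) (norm_nonneg x))
    rw [← ofReal_measureReal, ← ENNReal.ofReal_mul hC.le]
    exact ENNReal.ofReal_le_ofReal ((abs_det_le_phi ht _ h1).trans (hCb w).2)
  rw [ae_iff]
  simp only [not_not]
  refine measure_setOfPred_frequently_eq_zero (p := fun k a => (x, a) ∈ collision T j l s k) ?_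
  refine ne_top_of_le_ne_top (ENNReal.mul_ne_top (ENNReal.mul_ne_top hM (ENNReal.ofReal_ne_top (r := C)))
    hsum) ?_
  rw [← ENNReal.tsum_mul_left]
  refine ENNReal.tsum_le_tsum fun k => ?_
  have hsub : {a | (x, a) ∈ collision T j l s k} ∩ Metric.closedBall 0 s ⊆
      ⋃ r ∈ (Finset.univ : Finset (Fin k → Fin m)).filter
        (fun r => x 0 ≠ extend (j 0) (List.ofFn r ++ trunc j (l k)) 0),
      {a | a ∈ Metric.closedBall 0 s ∧
        proj T a x - proj T a (extend (j 0) (List.ofFn r ++ trunc j (l k))) ∈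
          wordMap T (List.ofFn r ++ trunc j (l k)) '' Metric.closedBall 0 (4 * s)} := by
    rintro a ⟨⟨r, hr1, hr2⟩, ha⟩
    exact Set.mem_biUnion (x := r) (by simpa using hr1) ⟨ha, hr2⟩
  calc volume.restrict (Metric.closedBall 0 s) {a | (x, a) ∈ collision T j l s k}
      = volume ({a | (x, a) ∈ collision T j l s k} ∩ Metric.closedBall 0 s) :=
        Measure.restrict_apply' Metric.isClosed_closedBall.measurableSet
    _ ≤ _ := (measure_mono hsub).trans (measure_biUnion_finset_le _ _)
    _ ≤ ∑ r ∈ (Finset.univ : Finset (Fin k → Fin m)).filter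
          (fun r => x 0 ≠ extend (j 0) (List.ofFn r ++ trunc j (l k)) 0),
        M * ENNReal.ofReal C * μ (cylinder (List.ofFn r ++ trunc j (l k))) := by
      refine Finset.sum_le_sum fun r hr => ?_
      refine (hMb x _ (Finset.mem_filter.1 hr).2 _).trans ?_
      rw [mul_assoc]
      gcongr
      exact hdet _
    _ ≤ ∑ r, M * ENNReal.ofReal C * μ (cylinder (List.ofFn r ++ trunc j (l k))) :=
      Finset.sum_le_sum_of_subset (Finset.filter_subset _ _)
    -- Invariance sums out the free prefix, leaving the convergent series of the hypothesis.
    _ = _ := by rw [← Finset.mul_sum, sum_measure_cylinder_append hμ.invariant]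

theorem shift_iterate_mem_recurringSet (hmono : Monotone l) {i : ℕ → Fin m}
    (hi : i ∈ recurringSet j l) (p : ℕ) : shift^[p] i ∈ recurringSet j l := by
  rw [mem_recurringSet, frequently_atTop] at hi ⊢
  intro n
  obtain ⟨k, hk, hik⟩ := hi (n + p)
  refine ⟨k - p, by omega, ?_⟩
  rw [mem_recurEvent] at hik ⊢
  intro q hq
  rw [shift_iterate_apply, ← add_assoc, show p + (k - p) = k by omega]
  exact hik q (hq.trans_le (hmono (Nat.sub_le _ _)))

theorem frequently_collision (hbij : ∀ i, Function.Bijective (T i)) (hmono : Monotone l)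
    (hρ0 : 0 ≤ ρ) (hρ1 : ρ < 1 / 2) (hρ : ∀ i x, ‖T i x‖ ≤ ρ * ‖x‖) {s : ℝ}
    {a : Fin m → EuclideanSpace ℝ (Fin d)} (ha : ‖a‖ ≤ s) {i i' : ℕ → Fin m}
    (hi' : i' ∈ recurringSet j l) (hne : i ≠ i') (hproj : proj T a i = proj T a i') :
    ∃ p, ∃ᶠ k in atTop, (shift^[p] i, a) ∈ collision T j l s k := by
  classical
  have hρ2 : ρ < 1 := by linarith
  have hex : ∃ n, i n ≠ i' n := Function.ne_iff.1 hne
  set p := Nat.find hex with hp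
  have hpre : trunc i p = trunc i' p :=
    trunc_eq_trunc_iff.2 fun n hn => not_not.1 (Nat.find_min hex hn)
  have hpne : shift^[p] i 0 ≠ shift^[p] i' 0 := by
    simpa only [shift_iterate_apply, add_zero] using Nat.find_spec hex
  have hx : proj T a (shift^[p] i) = proj T a (shift^[p] i') := by
    rw [proj_eq_wordAffine hρ0 hρ2 hρ a i p, proj_eq_wordAffine hρ0 hρ2 hρ a i' p, hpre,
      wordAffine_eq, wordAffine_eq _ (proj T a (shift^[p] i'))] at hproj
    exact wordMap_injective hbij _ (add_right_cancel hproj)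
  refine ⟨p, ?_⟩
  have hR := mem_recurringSet.1 (shift_iterate_mem_recurringSet hmono hi' p)
  -- Discarding $k=0$ makes the word `w` nonempty, so it begins with the first letter of
  -- $\sigma^p\mathbf i'$.
  refine (hR.and_eventually (eventually_gt_atTop 0)).mono ?_
  rintro k ⟨hk, hk0⟩
  set x' := shift^[p] i' with hx'
  set w := List.ofFn (fun n : Fin k => x' n) ++ trunc j (l k) with hw
  have hxw : x' ∈ cylinder w := by
    rw [hw, cylinder_append]
    refine ⟨trunc_eq_of_mem_cylinder_ofFn.2 rfl, ?_⟩
    rw [List.length_ofFn]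
    exact hk
  refine ⟨fun n => x' n, ?_, ?_⟩
  · have h1 := mem_cylinder_iff.1 hxw 0 (by simp [hw]; omega)
    have h2 := mem_cylinder_iff.1 (extend_mem_cylinder (j 0) w) 0 (by simp [hw]; omega)
    change shift^[p] i 0 ≠ extend (j 0) w 0
    rw [h2, ← h1]
    exact hpne
  · change proj T a (shift^[p] i) - proj T a (extend (j 0) w) ∈ _
    rw [hx]
    exact proj_sub_proj_mem_image hρ0 hρ1 hρ ha hxw (extend_mem_cylinder _ _)

theorem ae_map_image_recurringSet_eq_zero (hbij : ∀ i, Function.Bijective (T i))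
    (hmono : Monotone l) (ht : t ∈ Set.Icc (0 : ℝ) d) (hμ : IsGibbsMeasure T t μ)
    (hzero : HasPressure T t 0) (hρ0 : 0 ≤ ρ) (hρ1 : ρ < 1 / 2)
    (hρ : ∀ i x, ‖T i x‖ ≤ ρ * ‖x‖) (hsum : ∑' k, μ (cylinder (trunc j (l k))) ≠ ⊤) :
    ∀ᵐ a : Fin m → EuclideanSpace ℝ (Fin d),
      μ.map (proj T a) (proj T a '' recurringSet j l) = 0 := by
  have := hμ.isProbabilityMeasure
  have hρ2 : ρ < 1 := by linarith
  have hfub : ∀ s : ℕ, ∀ᵐ a : Fin m → EuclideanSpace ℝ (Fin d), a ∈ Metric.closedBall 0 (s : ℝ) →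
      ∀ᵐ x ∂μ, ¬ ∃ᶠ k in atTop, (x, a) ∈ collision T j l s k := fun s => by
    rw [← ae_restrict_iff' Metric.isClosed_closedBall.measurableSet]
    have hm : MeasurableSet {p : (ℕ → Fin m) × (Fin m → EuclideanSpace ℝ (Fin d)) |
        ¬ ∃ᶠ k in atTop, p ∈ collision T j l s k} := by
      have : {p | ¬ ∃ᶠ k in atTop, p ∈ collision T j l s k} =
          (limsup (collision T j l s) atTop)ᶜ := by
        ext p
        rw [Set.mem_compl_iff, mem_limsup_iff_frequently_mem]
        rfl
      rw [this]
      exact (MeasurableSet.measurableSet_limsup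
        fun k => measurableSet_collision hρ0 hρ2 hρ s k).compl
    -- Fubini: the estimate holds for every $x$ and almost every $a$, while the conclusion needs the
    -- quantifiers exchanged.
    exact (Measure.ae_ae_comm hm).1
      (ae_of_all _ fun x => ae_not_frequently_collision ht hμ hzero hρ0 hρ1 hρ hsum s x)
  have hR0 := measure_recurringSet_eq_zero hμ.invariant hsum
  filter_upwards [ae_all_iff.2 hfub] with a ha
  refine map_image_eq_zero_of_subset_null (continuous_proj hρ0 hρ2 hρ a) ?_
  obtain ⟨s, hs⟩ := exists_nat_ge ‖a‖
  have h1 := ha s (mem_closedBall_zero_iff.2 hs)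
  have h2 : ∀ᵐ i ∂μ, ∀ p, ¬ ∃ᶠ k in atTop, (shift^[p] i, a) ∈ collision T j l s k :=
    ae_all_iff.2 fun p => (hμ.invariant.iterate p).quasiMeasurePreserving.ae h1
  have h3 : ∀ᵐ i ∂μ, i ∉ recurringSet j l := measure_eq_zero_iff_ae_notMem.1 hR0
  rw [measure_eq_zero_iff_ae_notMem]
  filter_upwards [h2, h3] with i hi hiR
  rintro ⟨i', hi', heq⟩
  obtain ⟨p, hp⟩ := frequently_collision hbij hmono hρ0 hρ1 hρ hs hi'
    (fun h => hiR (by rwa [h])) heq.symm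
  exact hi p hp

theorem map_image_recurringSet_eq_zero_of_ae_unique (hμ : IsGibbsMeasure T t μ) (hρ0 : 0 ≤ ρ)
    (hρ1 : ρ < 1) (hρ : ∀ i x, ‖T i x‖ ≤ ρ * ‖x‖)
    (hsum : ∑' k, μ (cylinder (trunc j (l k))) ≠ ⊤) (a : Fin m → EuclideanSpace ℝ (Fin d))
    (ha : ∀ᵐ i ∂μ, ∀ i', proj T a i' = proj T a i → i' = i) :
    μ.map (proj T a) (proj T a '' recurringSet j l) = 0 := by
  have := hμ.isProbabilityMeasure
  refine map_image_eq_zero_of_subset_null (continuous_proj hρ0 hρ1 hρ a) ?_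
  have h3 : ∀ᵐ i ∂μ, i ∉ recurringSet j l :=
    measure_eq_zero_iff_ae_notMem.1 (measure_recurringSet_eq_zero hμ.invariant hsum)
  rw [measure_eq_zero_iff_ae_notMem]
  filter_upwards [ha, h3] with i hi hiR
  rintro ⟨i', hi', heq⟩
  exact hiR (hi i' heq ▸ hi')

/-- As $\varphi^0=1$, the pressure at $0$ is $\log m$. This settles $t=0$, where $\rho^t$ gives no
decay. -/
theorem eq_one_of_hasPressure_zero (h : HasPressure T 0 0) (hm : 0 < m) : m = 1 := by
  have h1 : Tendsto (fun _ : ℕ => Real.log m) atTop (𝓝 0) := by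
    refine Tendsto.congr' ?_ h
    filter_upwards [eventually_gt_atTop 0] with k hk
    have : (k : ℝ) ≠ 0 := by positivity
    simp [phi]
    field_simp
  have h2 := tendsto_nhds_unique tendsto_const_nhds h1
  have h3 : (0 : ℝ) < m := by exact_mod_cast hm
  have h4 := Real.eq_one_of_pos_of_log_eq_zero h3 h2
  exact_mod_cast h4

theorem measure_recurringSet_eq_one_of_gibbs (ht : 0 ≤ t)
    (hquasi : ∃ D ∈ Set.Ioo (0 : ℝ) 1, ∀ q r : List (Fin m),
      D * phi t (wordMap T q) * phi t (wordMap T r) ≤ phi t (wordMap T (q ++ r)))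
    (hμ : IsGibbsMeasure T t μ) (hzero : HasPressure T t 0) (hmono : Monotone l)
    (hρ0 : 0 ≤ ρ) (hρ1 : ρ < 1) (hρ : ∀ i x, ‖T i x‖ ≤ ρ * ‖x‖)
    (hsum : ∑' k, μ (cylinder (trunc j (l k))) = ⊤) : μ (recurringSet j l) = 1 := by
  have := hμ.isProbabilityMeasure
  rcases ht.eq_or_lt with h0 | h0
  · subst h0
    have hm : m = 1 := eq_one_of_hasPressure_zero hzero (Nat.pos_of_ne_zero fun h => by
      subst h; exact (j 0).elim0)
    subst hm
    have : recurringSet j l = Set.univ := Set.eq_univ_of_forall fun i =>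
      mem_recurringSet.2 (Frequently.of_forall fun k => mem_recurEvent.2 fun _ _ =>
        Subsingleton.elim _ _)
    rw [this, measure_univ]
  · obtain ⟨c, hc0, hc⟩ := hμ.exists_mul_le hzero hquasi
    obtain ⟨C, hC, hCb⟩ := hμ.exists_bounds hzero
    refine measure_recurringSet_eq_one hμ.invariant hmono hc0 (sq_nonneg C)
      (Real.rpow_nonneg hρ0 t) (Real.rpow_lt_one hρ0 hρ1 h0) hc (fun q r => ?_) fun hs => ?_
    · have h1 : phi t (wordMap T (q ++ r)) ≤ (ρ ^ t) ^ q.length * phi t (wordMap T r) := by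
        rw [wordMap_append, ← Real.rpow_mul_natCast hρ0, mul_comm t, Real.rpow_natCast_mul hρ0]
        exact phi_mul_le ht (pow_nonneg hρ0 _) _ _ (norm_wordMap_apply_le hρ0 hρ q)
      calc μ.real (cylinder (q ++ r)) ≤ C * phi t (wordMap T (q ++ r)) := (hCb _).1
        _ ≤ C * ((ρ ^ t) ^ q.length * (C * μ.real (cylinder r))) := by
          refine mul_le_mul_of_nonneg_left (h1.trans ?_) hC.le
          exact mul_le_mul_of_nonneg_left (hCb r).2 (pow_nonneg (Real.rpow_nonneg hρ0 t) _)
        _ = _ := by ring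
    · have hlt := hs.tsum_ofReal_lt_top
      rw [tsum_congr fun k => (ofReal_measureReal (μ := μ) (s := recurEvent j l k)).trans
        (measure_recurEvent hμ.invariant j l k)] at hlt
      exact hlt.ne hsum

/-- This reconciles the series from $k=1$ in the theorem with the events indexed from $0$. -/
theorem tsum_succ_eq_top_iff {f : ℕ → ENNReal} (h : f 0 ≠ ⊤) :
    ∑' k, f (k + 1) = ⊤ ↔ ∑' k, f k = ⊤ := by
  rw [tsum_eq_zero_add' (f := f) ENNReal.summable, ENNReal.add_eq_top]
  simp [h]

end Main

end SelfAffine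

theorem mainTheorem3 {d m : ℕ}
    (T : Fin m → Module.End ℝ (EuclideanSpace ℝ (Fin d)))
    (hbij : ∀ i, Function.Bijective (T i))
    (hhalf : ∀ i, (T i).singularValues 0 < 1 / 2)
    (t : ℝ) (ht : t ∈ Set.Icc (0 : ℝ) d)
    (hquasi : ∃ D ∈ Set.Ioo (0 : ℝ) 1, ∀ q r : List (Fin m),
      D * SelfAffine.phi t (SelfAffine.wordMap T q) * SelfAffine.phi t (SelfAffine.wordMap T r) ≤
        SelfAffine.phi t (SelfAffine.wordMap T (q ++ r)))
    (hzero : SelfAffine.HasPressure T t 0)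
    (μ : Measure (ℕ → Fin m)) (hμ : SelfAffine.IsGibbsMeasure T t μ)
    (l : ℕ → ℕ) (hmono : Monotone l) (hlim : Tendsto l atTop atTop)
    (j : ℕ → Fin m) :
    (∑' k : ℕ, μ (SelfAffine.cylinder (SelfAffine.trunc j (l (k + 1)))) = ⊤ →
      ∀ a : Fin m → EuclideanSpace ℝ (Fin d),
        μ.map (SelfAffine.proj T a)
          (SelfAffine.proj T a '' SelfAffine.recurringSet j l) = 1) ∧
    (∑' k : ℕ, μ (SelfAffine.cylinder (SelfAffine.trunc j (l (k + 1)))) ≠ ⊤ →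
      (∀ a : Fin m → EuclideanSpace ℝ (Fin d),
        (∀ᵐ i ∂μ, ∀ i', SelfAffine.proj T a i' = SelfAffine.proj T a i → i' = i) →
          μ.map (SelfAffine.proj T a)
            (SelfAffine.proj T a '' SelfAffine.recurringSet j l) = 0) ∧
      ∀ᵐ a : Fin m → EuclideanSpace ℝ (Fin d),
        μ.map (SelfAffine.proj T a)
          (SelfAffine.proj T a '' SelfAffine.recurringSet j l) = 0) := by
  have hprob := hμ.isProbabilityMeasure
  obtain ⟨ρ, hρ0, hρ1, hρ⟩ := SelfAffine.exists_ratio hhalf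
  have hρ2 : ρ < 1 := by linarith
  rw [ne_eq, SelfAffine.tsum_succ_eq_top_iff
    (f := fun k => μ (SelfAffine.cylinder (SelfAffine.trunc j (l k)))) (measure_ne_top _ _)]
  refine ⟨fun hsum a => ?_, fun hsum => ⟨fun a ha => ?_, ?_⟩⟩
  · have hm := (SelfAffine.continuous_proj hρ0 hρ2 hρ a).measurable
    have := Measure.isProbabilityMeasure_map hm.aemeasurable (μ := μ)
    refine le_antisymm prob_le_one ?_
    rw [← SelfAffine.measure_recurringSet_eq_one_of_gibbs ht.1 hquasi hμ hzero hmono hρ0 hρ2 hρ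
      hsum]
    -- This inequality holds for outer measures, so measurability of the image is not needed.
    exact Measure.le_map_apply_image hm.aemeasurable _
  · exact SelfAffine.map_image_recurringSet_eq_zero_of_ae_unique hμ hρ0 hρ2 hρ hsum a ha
  · exact SelfAffine.ae_map_image_recurringSet_eq_zero hbij hmono ht hμ hzero hρ0 hρ1 hρ hsum
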